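/- A \emph{multiring} is a set $A$ with a commutative monoid structure $(A,\cdot,1)$, an element $0$, a map $-\colon A\to A$ and a multivalued sum assigning to $a,b\in A$ a nonempty subset $a+b\subseteq A$, such that for all $a,b,c,d$: $a\in b+c$ implies $c\in -b+a$ and $b\in a+(-c)$; $a\in b+0$ iff $a=b$; if $x\in g+c$ with $g\in a+b$, then $x\in a+h$ for some $h\in b+c$; $a+b=b+a$; $a\cdot 0=0$; and $a\in b+c$ implies $ad\in bd+cd$. A morphism $f$ satisfies $f(ab)=f(a)f(b)$, $f(0)=0$, $f(1)=1$, $f(-a)=-f(a)$, and $a\in b+c\Rightarrow f(a)\in f(b)+f(c)$; an isomorphism is a morphism with a two-sided inverse morphism. An ideal is a nonempty $I\subseteq A$ with $I+I\subseteq I$ and $AI\subseteq I$; it is prime if $1\notin I$ and $ab\in I$ implies $a\in I$ or $b\in I$. Let $\mathrm{spec}(A)$ be the set of prime ideals, with the topology having the sets $D(a)=\{p: a\notin p\}$ as a basis. Let $\mathrm{sper}(A)$ be the set of morphisms $\sigma\colon A\to\mathbf 3$, where $\mathbf 3=\{-1,0,1\}$ is the multiring with the usual product and $0+x=x+0=x+x=\{x\}$,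 $1+(-1)=(-1)+1=\mathbf 3$, with the topology generated by the sets $\{\sigma:\sigma(a_1)=\dots=\sigma(a_n)=1\}$. For $X=\mathrm{spec}(A)$ or $\mathrm{sper}(A)$, $X_{const}$ is $X$ with the constructible topology, generated by the compact open subsets of $X$ and their complements. For an ideal $I$, $A/I$ is the multiring of classes for $a\sim b\iff (a-b)\cap I\neq\emptyset$, where $\bar a\in\bar b+\bar c$ iff $a'\in b'+c'$ for some representatives. For a multiplicative set $S$, $S^{-1}A$ is the multiring of fractions $a/s$, where $a/s=b/t$ iff $atu=bsu$ for some $u\in S$, and $a/s\in b/t+c/u$ iff $atuv\in bsuv+cstv$ for some $v\in S$. For $p\in\mathrm{spec}(A)$ let $K_A(p)=S^{-1}(A/p)$ with $S=(A/p)\setminus\{0\}$. For $x,y\in A$ with $y\notin p$, $x/y$ also denotes $\bar x/\bar y\in K_A(p)$. Let $V(A)$ be the set of functions $f$ assigning to each $p\in\mathrm{spec}(A)$ an element $f(p)\in K_A(p)$ such that every $p$ lies in some clopen $U\subseteq\mathrm{spec}(A)_{const}$ for which there are $x,y\in A$ with $y\notin q$ and $f(q)=x/y$ in $K_A(q)$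 for all $q\in U$. With pointwise product, zero, unit and negation, and with $f\in g+h$ iff $f(p)\in g(p)+h(p)$ for all $p$, $V(A)$ is a multiring, and $v\colon A\to V(A)$, $v(a)(p)=a/1$, is a morphism. \textbf{Theorem.} Let $A$ be a multiring and $v\colon A\to V(A)$ as above. (i) The map $\mathrm{spec}(V(A))\to\mathrm{spec}(A)_{const}$, $p\mapsto v^{-1}(p)$, is a homeomorphism. (ii) The map $\mathrm{sper}(V(A))\to\mathrm{sper}(A)_{const}$, $\sigma\mapsto\sigma\circ v$, is a homeomorphism. (iii) For every $p\in\mathrm{spec}(V(A))$, with $q=v^{-1}(p)$, the morphism $K_A(q)\to K_{V(A)}(p)$, $x/y\mapsto v(x)/v(y)$, induced by $v$ is an isomorphism. -/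

import Mathlib

universe u v w

/-- A (commutative, unital) multiring: a commutative monoid with zero together with a unary
operation `-` and a multivalued addition `hadd a b`, a nonempty subset of `A`. -/
class Multiring (A : Type u) extends CommMonoidWithZero A, Neg A where
  /-- the multivalued sum `a + b`, a subset of `A` -/
  hadd : A → A → Set A
  hadd_nonempty : ∀ a b : A, (hadd a b).Nonempty
  mem_hadd_reverse : ∀ {a b c : A}, a ∈ hadd b c → c ∈ hadd (-b) a ∧ b ∈ hadd a (-c)
  mem_hadd_zero : ∀ {a b : A}, a ∈ hadd b 0 ↔ a = b
  hadd_assoc : ∀ {a b c g x : A}, x ∈ hadd g c → g ∈ hadd a b → ∃ h ∈ hadd b c, x ∈ hadd a h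
  hadd_comm : ∀ a b : A, hadd a b = hadd b a
  mul_mem_hadd : ∀ {a b c : A}, a ∈ hadd b c → ∀ d : A, a * d ∈ hadd (b * d) (c * d)

namespace Multiring

section Basic

variable {A : Type u} [Multiring A]

theorem hadd_swap {a b c : A} (h : a ∈ hadd b c) : a ∈ hadd c b := by
  rwa [hadd_comm]

theorem zero_mem_hadd_neg (a : A) : (0 : A) ∈ hadd a (-a) :=
  hadd_swap (mem_hadd_reverse ((mem_hadd_zero (a := a) (b := a)).2 rfl)).1

theorem eq_neg_of_zero_mem {a b : A} (h : (0 : A) ∈ hadd a b) : b = -a :=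
  mem_hadd_zero.1 (mem_hadd_reverse h).1

protected theorem neg_zero : -(0 : A) = 0 :=
  (eq_neg_of_zero_mem (mem_hadd_zero.2 rfl)).symm

protected theorem neg_neg (a : A) : -(-a) = a :=
  (eq_neg_of_zero_mem (hadd_swap (zero_mem_hadd_neg a))).symm

protected theorem neg_mul (a b : A) : -(a * b) = -a * b := by
  have h := mul_mem_hadd (zero_mem_hadd_neg a) b
  rw [zero_mul] at h
  exact (eq_neg_of_zero_mem h).symm

/-- `c ∈ a - b` implies `a ∈ b + c`. -/
theorem mem_hadd_of_mem_sub {a b c : A} (h : c ∈ hadd a (-b)) : a ∈ hadd b c := by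
  have := (mem_hadd_reverse h).2
  rw [Multiring.neg_neg] at this
  exact hadd_swap this

/-- `a ∈ b + c` implies `c ∈ a - b`. -/
theorem mem_sub_of_mem_hadd {a b c : A} (h : a ∈ hadd b c) : c ∈ hadd a (-b) :=
  hadd_swap (mem_hadd_reverse h).1

theorem neg_mem_hadd {a b c : A} (h : a ∈ hadd b c) : -a ∈ hadd (-b) (-c) := by
  have h1 : -b ∈ hadd c (-a) := (mem_hadd_reverse (mem_hadd_reverse h).1).2
  exact hadd_swap (mem_hadd_reverse h1).1

theorem neg_mem_sub {a b c : A} (h : c ∈ hadd a (-b)) : -c ∈ hadd b (-a) := by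
  have := neg_mem_hadd h
  rw [Multiring.neg_neg] at this
  exact hadd_swap this

theorem hadd_assoc' {a b c g x : A} (h1 : x ∈ hadd a g) (h2 : g ∈ hadd b c) :
    ∃ h ∈ hadd a b, x ∈ hadd h c := by
  obtain ⟨h, hh, hx⟩ := hadd_assoc (hadd_swap h1) (hadd_swap h2)
  exact ⟨h, hadd_swap hh, hadd_swap hx⟩

/-- `(b + i) + (c + j) ⊆ (b + c) + (i + j)`. -/
theorem hadd_hadd_hadd_comm {x b i c j y z : A} (hx : x ∈ hadd y z) (hy : y ∈ hadd b i)
    (hz : z ∈ hadd c j) : ∃ k ∈ hadd b c, ∃ l ∈ hadd i j, x ∈ hadd k l := by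
  obtain ⟨m, hm, hx1⟩ := hadd_assoc hx hy
  obtain ⟨n, hn, hm1⟩ := hadd_assoc (hadd_swap hm) hz
  obtain ⟨k, hk, hx2⟩ := hadd_assoc' hx1 hm1
  exact ⟨k, hk, n, hadd_swap hn, hx2⟩

end Basic

/-- Morphisms of multirings. -/
structure Hom (A : Type u) (B : Type v) [Multiring A] [Multiring B] extends A →*₀ B where
  map_neg' : ∀ a, toFun (-a) = -toFun a
  map_hadd' : ∀ {a b c : A}, a ∈ hadd b c → toFun a ∈ hadd (toFun b) (toFun c)

namespace Hom

variable {A : Type u} {B : Type v} {C : Type w} [Multiring A] [Multiring B] [Multiring C]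

instance : FunLike (Hom A B) A B where
  coe f := f.toFun
  coe_injective := by
    rintro ⟨f, _, _⟩ ⟨g, _, _⟩ h
    congr
    exact DFunLike.coe_injective h

instance : MonoidWithZeroHomClass (Hom A B) A B where
  map_mul f := f.map_mul'
  map_one f := f.map_one'
  map_zero f := f.map_zero'

theorem map_neg (f : Hom A B) (a : A) : f (-a) = -f a := f.map_neg' a

theorem map_hadd (f : Hom A B) {a b c : A} (h : a ∈ hadd b c) : f a ∈ hadd (f b) (f c) :=
  f.map_hadd' h

@[ext]
theorem ext {f g : Hom A B} (h : ∀ a, f a = g a) : f = g := DFunLike.ext f g h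

/-- Composition of morphisms. -/
def comp (g : Hom B C) (f : Hom A B) : Hom A C where
  toMonoidWithZeroHom := g.toMonoidWithZeroHom.comp f.toMonoidWithZeroHom
  map_neg' a := (congrArg g (f.map_neg a)).trans (g.map_neg _)
  map_hadd' h := g.map_hadd (f.map_hadd h)

/-- A morphism of multirings is an isomorphism if it has a two-sided inverse morphism. -/
def IsIso (f : Hom A B) : Prop :=
  ∃ g : Hom B A, (∀ a, g (f a) = a) ∧ ∀ b, f (g b) = b

end Hom

/-- Ideals: nonempty subsets `I` with `I + I ⊆ I` and `A I ⊆ I`. -/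
@[ext]
structure MIdeal (A : Type u) [Multiring A] where
  carrier : Set A
  zero_mem' : (0 : A) ∈ carrier
  hadd_mem' : ∀ {x y z : A}, x ∈ carrier → y ∈ carrier → z ∈ hadd x y → z ∈ carrier
  mul_mem' : ∀ (a : A) {x : A}, x ∈ carrier → a * x ∈ carrier

instance (A : Type u) [Multiring A] : SetLike (MIdeal A) A where
  coe := MIdeal.carrier
  coe_injective _ _ := MIdeal.ext

/-- The prime spectrum: proper ideals `p` with `a b ∈ p` only if `a ∈ p` or `b ∈ p`. -/
@[ext]
structure MSpec (A : Type u) [Multiring A] extends MIdeal A where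
  one_notMem' : (1 : A) ∉ carrier
  mem_or_mem' : ∀ {a b : A}, a * b ∈ carrier → a ∈ carrier ∨ b ∈ carrier

instance (A : Type u) [Multiring A] : SetLike (MSpec A) A where
  coe p := p.carrier
  coe_injective _ _ := MSpec.ext

section IdealBasic

variable {A : Type u} {B : Type v} [Multiring A] [Multiring B]

theorem MIdeal.neg_mem (I : MIdeal A) {x : A} (hx : x ∈ I) : -x ∈ I := by
  have h := I.mul_mem' (-1) hx
  rwa [← Multiring.neg_mul, one_mul] at h

theorem MSpec.one_notMem (p : MSpec A) : (1 : A) ∉ p := p.one_notMem'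

theorem MSpec.mul_notMem (p : MSpec A) {a b : A} (ha : a ∉ p) (hb : b ∉ p) : a * b ∉ p :=
  fun h => (p.mem_or_mem' h).elim ha hb

/-- The inverse image of a prime ideal under a morphism. -/
def MSpec.comap (f : Hom A B) (p : MSpec B) : MSpec A where
  carrier := {a | f a ∈ p}
  zero_mem' := by
    change f 0 ∈ p
    rw [map_zero]
    exact p.zero_mem'
  hadd_mem' hx hy hz := p.hadd_mem' hx hy (f.map_hadd hz)
  mul_mem' a x hx := by
    change f (a * x) ∈ p
    rw [map_mul]
    exact p.mul_mem' _ hx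
  one_notMem' h := by
    change f 1 ∈ p at h
    rw [map_one] at h
    exact p.one_notMem h
  mem_or_mem' {a b} h := by
    change f (a * b) ∈ p at h
    rw [map_mul] at h
    exact p.mem_or_mem' h

end IdealBasic

section IdealQuotient

variable {A : Type u} [Multiring A]

/-- `a ∼ b` modulo `I` if `(a - b) ∩ I ≠ ∅`. -/
def MIdeal.con (I : MIdeal A) : Con A where
  r a b := (hadd a (-b) ∩ (I : Set A)).Nonempty
  iseqv :=
    { refl := fun a => ⟨0, zero_mem_hadd_neg a, I.zero_mem'⟩
      symm := fun ⟨x, hx, hI⟩ => ⟨-x, neg_mem_sub hx, I.neg_mem hI⟩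
      trans := by
        rintro a b c ⟨x, hx, hxI⟩ ⟨y, hy, hyI⟩
        obtain ⟨h, hh, ha⟩ := hadd_assoc (mem_hadd_of_mem_sub hx) (mem_hadd_of_mem_sub hy)
        exact ⟨h, mem_sub_of_mem_hadd ha, I.hadd_mem' hyI hxI hh⟩ }
  mul' := by
    rintro a b c d ⟨x, hx, hxI⟩ ⟨y, hy, hyI⟩
    have h1 := mul_mem_hadd (mem_hadd_of_mem_sub hx) c
    have h2 := mul_mem_hadd (mem_hadd_of_mem_sub hy) b
    rw [mul_comm c b, mul_comm d b] at h2
    obtain ⟨h, hh, ha⟩ := hadd_assoc h1 h2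
    refine ⟨h, mem_sub_of_mem_hadd ha, I.hadd_mem' ?_ ?_ hh⟩
    · rw [mul_comm]
      exact I.mul_mem' _ hyI
    · rw [mul_comm]
      exact I.mul_mem' _ hxI

/-- The quotient `A / I`. -/
def IdealQuotient (I : MIdeal A) : Type u := I.con.Quotient

namespace IdealQuotient

variable (I : MIdeal A)

instance : CommMonoid (IdealQuotient I) := inferInstanceAs (CommMonoid I.con.Quotient)

variable {I}

/-- The class of `a` in `A / I`. -/
def mk (a : A) : IdealQuotient I := ((a : A) : I.con.Quotient)

theorem mk_surjective : Function.Surjective (mk : A → IdealQuotient I) :=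
  Quotient.exists_rep

theorem mk_eq_mk {a b : A} :
    (mk a : IdealQuotient I) = mk b ↔ (hadd a (-b) ∩ (I : Set A)).Nonempty :=
  Con.eq I.con

theorem mk_eq_of_mem {a b i : A} (hi : i ∈ I) (h : a ∈ hadd b i) :
    (mk a : IdealQuotient I) = mk b :=
  mk_eq_mk.2 ⟨i, mem_sub_of_mem_hadd h, hi⟩

theorem exists_of_mk_eq {a b : A} (h : (mk a : IdealQuotient I) = mk b) :
    ∃ i ∈ I, a ∈ hadd b i :=
  let ⟨i, hi, hI⟩ := mk_eq_mk.1 h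
  ⟨i, hI, mem_hadd_of_mem_sub hi⟩

theorem mk_mul (a b : A) : (mk (a * b) : IdealQuotient I) = mk a * mk b := rfl

instance : CommMonoidWithZero (IdealQuotient I) where
  zero := mk 0
  zero_mul a := by
    obtain ⟨a, rfl⟩ := mk_surjective a
    exact congrArg mk (zero_mul a)
  mul_zero a := by
    obtain ⟨a, rfl⟩ := mk_surjective a
    exact congrArg mk (mul_zero a)

theorem mk_zero : (mk 0 : IdealQuotient I) = 0 := rfl

theorem mk_one : (mk 1 : IdealQuotient I) = 1 := rfl

theorem mk_eq_zero {a : A} : (mk a : IdealQuotient I) = 0 ↔ a ∈ I := by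
  constructor
  · intro h
    obtain ⟨i, hi, ha⟩ := exists_of_mk_eq (h.trans mk_zero.symm)
    exact I.hadd_mem' I.zero_mem' hi ha
  · intro h
    exact mk_eq_of_mem h (hadd_swap (mem_hadd_zero.2 rfl))

instance : Neg (IdealQuotient I) where
  neg := Quotient.map' (fun a => -a) fun _ _ ⟨x, hx, hI⟩ => ⟨-x, neg_mem_hadd hx, I.neg_mem hI⟩

theorem mk_neg (a : A) : (mk (-a) : IdealQuotient I) = -mk a := rfl

/-- The sum in `A / I`: `X ∈ Y + Z` if `a ∈ b + c` for some representatives. -/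
def qadd (Y Z : IdealQuotient I) : Set (IdealQuotient I) :=
  {X | ∃ a b c : A, mk a = X ∧ mk b = Y ∧ mk c = Z ∧ a ∈ hadd b c}

theorem mk_mem_qadd {a b c : A} : (mk a : IdealQuotient I) ∈ qadd (mk b) (mk c) ↔
    ∃ a', (mk a' : IdealQuotient I) = mk a ∧ a' ∈ hadd b c := by
  constructor
  · rintro ⟨a1, b1, c1, ha, hb, hc, h⟩
    obtain ⟨i, hi, hb⟩ := exists_of_mk_eq hb
    obtain ⟨j, hj, hc⟩ := exists_of_mk_eq hc
    obtain ⟨k, hk, l, hl, h⟩ := hadd_hadd_hadd_comm h hb hc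
    refine ⟨k, ?_, hk⟩
    rw [← ha]
    exact (mk_eq_of_mem (I.hadd_mem' hi hj hl) h).symm
  · rintro ⟨a', ha, h⟩
    exact ⟨a', b, c, ha, rfl, rfl, h⟩

instance : Multiring (IdealQuotient I) where
  hadd := qadd
  hadd_nonempty a b := by
    obtain ⟨a, rfl⟩ := mk_surjective a
    obtain ⟨b, rfl⟩ := mk_surjective b
    obtain ⟨x, hx⟩ := hadd_nonempty a b
    exact ⟨mk x, mk_mem_qadd.2 ⟨x, rfl, hx⟩⟩
  mem_hadd_reverse := by
    rintro _ _ _ ⟨a, b, c, rfl, rfl, rfl, h⟩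
    exact ⟨⟨c, -b, a, rfl, rfl, rfl, (mem_hadd_reverse h).1⟩,
      ⟨b, a, -c, rfl, rfl, rfl, (mem_hadd_reverse h).2⟩⟩
  mem_hadd_zero := by
    intro a b
    obtain ⟨a, rfl⟩ := mk_surjective a
    obtain ⟨b, rfl⟩ := mk_surjective b
    rw [← mk_zero, mk_mem_qadd]
    constructor
    · rintro ⟨a', ha, h⟩
      rw [← ha, mem_hadd_zero.1 h]
    · intro h
      exact ⟨b, h.symm, mem_hadd_zero.2 rfl⟩
  hadd_assoc := by
    intro a b c g x hx hg
    obtain ⟨a, rfl⟩ := mk_surjective a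
    obtain ⟨b, rfl⟩ := mk_surjective b
    obtain ⟨c, rfl⟩ := mk_surjective c
    obtain ⟨g, rfl⟩ := mk_surjective g
    obtain ⟨x, rfl⟩ := mk_surjective x
    obtain ⟨g', hg', hg⟩ := mk_mem_qadd.1 hg
    rw [← hg'] at hx
    obtain ⟨x', hx', hx⟩ := mk_mem_qadd.1 hx
    obtain ⟨h, hh, hx⟩ := hadd_assoc hx hg
    exact ⟨mk h, mk_mem_qadd.2 ⟨h, rfl, hh⟩, mk_mem_qadd.2 ⟨x', hx', hx⟩⟩
  hadd_comm := by
    have key : ∀ a b : IdealQuotient I, qadd a b ⊆ qadd b a := by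
      rintro _ _ _ ⟨a, b, c, rfl, rfl, rfl, h⟩
      exact ⟨a, c, b, rfl, rfl, rfl, hadd_swap h⟩
    exact fun a b => (key a b).antisymm (key b a)
  mul_mem_hadd := by
    rintro _ _ _ ⟨a, b, c, rfl, rfl, rfl, h⟩ d
    obtain ⟨d, rfl⟩ := mk_surjective d
    exact ⟨a * d, b * d, c * d, rfl, rfl, rfl, mul_mem_hadd h d⟩

/-- The morphism `A / I → B / J` induced by a morphism `f : A → B` with `I ⊆ f⁻¹(J)`. -/
def map {B : Type v} [Multiring B] (f : Hom A B) (I : MIdeal A) (J : MIdeal B)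
    (hIJ : ∀ a ∈ I, f a ∈ J) : Hom (IdealQuotient I) (IdealQuotient J) where
  toFun := Quotient.lift (fun a => (mk (f a) : IdealQuotient J)) (by
    rintro a b ⟨x, hx, hI⟩
    refine mk_eq_mk.2 ⟨f x, ?_, hIJ x hI⟩
    rw [← f.map_neg]
    exact f.map_hadd hx)
  map_zero' := by
    change mk (f 0) = _
    rw [map_zero, mk_zero]
  map_one' := by
    change mk (f 1) = _
    rw [map_one, mk_one]
  map_mul' a b := by
    obtain ⟨a, rfl⟩ := mk_surjective a
    obtain ⟨b, rfl⟩ := mk_surjective b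
    change mk (f (a * b)) = mk (f a) * mk (f b)
    rw [map_mul, mk_mul]
  map_neg' a := by
    obtain ⟨a, rfl⟩ := mk_surjective a
    change mk (f (-a)) = -mk (f a)
    rw [f.map_neg, mk_neg]
  map_hadd' := by
    rintro _ _ _ ⟨a, b, c, rfl, rfl, rfl, h⟩
    exact ⟨f a, f b, f c, rfl, rfl, rfl, f.map_hadd h⟩

theorem map_mk {B : Type v} [Multiring B] (f : Hom A B) (I : MIdeal A) (J : MIdeal B)
    (hIJ : ∀ a ∈ I, f a ∈ J) (a : A) : map f I J hIJ (mk a) = mk (f a) := rfl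

end IdealQuotient

end IdealQuotient

section Loc

variable {A : Type u} [Multiring A] {S : Submonoid A}

open Localization

theorem loc_mk_eq_mk {a b : A} {s t : S} :
    Localization.mk a s = Localization.mk b t ↔ ∃ u : S, a * t * u = b * s * u := by
  rw [mk_eq_mk_iff, r_iff_exists]
  refine exists_congr fun u => ?_
  simp only [mul_comm, mul_left_comm]

theorem loc_mk_mul_mul (a : A) (s t : S) :
    Localization.mk (a * t) (s * t) = Localization.mk a s :=
  loc_mk_eq_mk.2 ⟨1, by push_cast; simp only [mul_comm, mul_left_comm]⟩

instance : Neg (Localization S) where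
  neg x := x.liftOn (fun a s => Localization.mk (-a) s) (by
    intro a c b d h
    obtain ⟨u, hu⟩ := loc_mk_eq_mk.1 (mk_eq_mk_iff.2 h)
    exact loc_mk_eq_mk.2 ⟨u, by simp only [← Multiring.neg_mul, hu]⟩)

theorem loc_neg_mk (a : A) (s : S) : -(Localization.mk a s) = Localization.mk (-a) s := rfl

/-- The sum in `S⁻¹ A`: `a / s ∈ b / t + c / u` if `a t u v ∈ b s u v + c s t v` for some `v ∈ S`. -/
def locAdd (Y Z : Localization S) : Set (Localization S) :=
  {X | ∃ (a b c : A) (s t u : S), X = Localization.mk a s ∧ Y = Localization.mk b t ∧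
    Z = Localization.mk c u ∧ ∃ v : S, a * t * u * v ∈ hadd (b * s * u * v) (c * s * t * v)}

theorem mk_mem_locAdd {a b c : A} {s t u : S} :
    Localization.mk a s ∈ locAdd (Localization.mk b t) (Localization.mk c u) ↔
      ∃ v : S, a * t * u * v ∈ hadd (b * s * u * v) (c * s * t * v) := by
  constructor
  · rintro ⟨a', b', c', s', t', u', ha, hb, hc, v, hv⟩
    obtain ⟨l, hl⟩ := loc_mk_eq_mk.1 ha
    obtain ⟨m, hm⟩ := loc_mk_eq_mk.1 hb
    obtain ⟨n, hn⟩ := loc_mk_eq_mk.1 hc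
    refine ⟨s' * t' * u' * l * m * n * v, ?_⟩
    have h := mul_mem_hadd hv (s * t * u * l * m * n)
    have e1 : a * t * u * ((s' * t' * u' * l * m * n * v : S) : A)
        = a' * t' * u' * v * (s * t * u * l * m * n) := by
      calc _ = (a * s' * l) * (t * u * t' * u' * m * n * v) := by
            push_cast; simp only [mul_comm, mul_left_comm]
        _ = _ := by rw [hl]; simp only [mul_comm, mul_left_comm]
    have e2 : b * s * u * ((s' * t' * u' * l * m * n * v : S) : A)
        = b' * s' * u' * v * (s * t * u * l * m * n) := by
      calc _ = (b * t' * m) * (s * u * s' * u' * l * n * v) := by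
            push_cast; simp only [mul_comm, mul_left_comm]
        _ = _ := by rw [hm]; simp only [mul_comm, mul_left_comm]
    have e3 : c * s * t * ((s' * t' * u' * l * m * n * v : S) : A)
        = c' * s' * t' * v * (s * t * u * l * m * n) := by
      calc _ = (c * u' * n) * (s * t * s' * t' * l * m * v) := by
            push_cast; simp only [mul_comm, mul_left_comm]
        _ = _ := by rw [hn]; simp only [mul_comm, mul_left_comm]
    rw [e1, e2, e3]
    exact h
  · rintro ⟨v, hv⟩
    exact ⟨a, b, c, s, t, u, rfl, rfl, rfl, v, hv⟩

theorem mk_mem_locAdd_same {a b c : A} {s : S} :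
    Localization.mk a s ∈ locAdd (Localization.mk b s) (Localization.mk c s) ↔
      ∃ v : S, a * v ∈ hadd (b * v) (c * v) := by
  rw [mk_mem_locAdd]
  constructor
  · rintro ⟨v, hv⟩
    refine ⟨s * s * v, ?_⟩
    push_cast
    simpa only [mul_assoc] using hv
  · rintro ⟨v, hv⟩
    refine ⟨v, ?_⟩
    have h := mul_mem_hadd hv (s * s)
    have e : ∀ x : A, x * v * (s * s) = x * s * s * v := fun x => by
      simp only [mul_comm, mul_left_comm]
    rwa [e, e, e] at h

theorem loc_common₂ (x y : Localization S) :
    ∃ (a b : A) (s : S), x = Localization.mk a s ∧ y = Localization.mk b s := by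
  induction x using Localization.induction_on with | _ x
  induction y using Localization.induction_on with | _ y
  refine ⟨x.1 * y.2, y.1 * x.2, x.2 * y.2, (loc_mk_mul_mul _ _ _).symm, ?_⟩
  rw [mul_comm x.2, loc_mk_mul_mul]

theorem loc_common₃ (x y z : Localization S) : ∃ (a b c : A) (s : S),
    x = Localization.mk a s ∧ y = Localization.mk b s ∧ z = Localization.mk c s := by
  obtain ⟨a, b, s, rfl, rfl⟩ := loc_common₂ x y
  induction z using Localization.induction_on with | _ z
  refine ⟨a * z.2, b * z.2, z.1 * s, s * z.2, (loc_mk_mul_mul _ _ _).symm,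
    (loc_mk_mul_mul _ _ _).symm, ?_⟩
  rw [mul_comm s, loc_mk_mul_mul]

theorem locAdd_comm (a b : Localization S) : locAdd a b = locAdd b a := by
  have key : ∀ a b : Localization S, locAdd a b ⊆ locAdd b a := by
    rintro _ _ _ ⟨a, b, c, s, t, u, rfl, rfl, rfl, v, h⟩
    refine ⟨a, c, b, s, u, t, rfl, rfl, rfl, v, ?_⟩
    rw [mul_assoc a, mul_comm (u : A), ← mul_assoc a]
    exact hadd_swap h
  exact (key a b).antisymm (key b a)

/-- The localization `S⁻¹ A` as a multiring. -/
instance : Multiring (Localization S) where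
  hadd := locAdd
  hadd_nonempty x y := by
    obtain ⟨a, b, s, rfl, rfl⟩ := loc_common₂ x y
    obtain ⟨c, hc⟩ := hadd_nonempty a b
    exact ⟨Localization.mk c s, mk_mem_locAdd_same.2 ⟨1, mul_mem_hadd hc _⟩⟩
  mem_hadd_reverse := by
    intro x y z h
    obtain ⟨a, b, c, s, rfl, rfl, rfl⟩ := loc_common₃ x y z
    obtain ⟨v, hv⟩ := mk_mem_locAdd_same.1 h
    rw [loc_neg_mk, loc_neg_mk, mk_mem_locAdd_same, mk_mem_locAdd_same]
    refine ⟨⟨v, ?_⟩, ⟨v, ?_⟩⟩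
    · rw [← Multiring.neg_mul]
      exact (mem_hadd_reverse hv).1
    · rw [← Multiring.neg_mul]
      exact (mem_hadd_reverse hv).2
  mem_hadd_zero := by
    intro x y
    obtain ⟨a, b, s, rfl, rfl⟩ := loc_common₂ x y
    rw [← mk_zero s, mk_mem_locAdd_same, loc_mk_eq_mk]
    simp only [zero_mul, mem_hadd_zero]
    constructor
    · rintro ⟨v, hv⟩
      exact ⟨v, by rw [mul_right_comm, hv, mul_right_comm]⟩
    · rintro ⟨v, hv⟩
      exact ⟨s * v, by push_cast; rw [← mul_assoc, hv, mul_assoc]⟩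
  hadd_assoc := by
    intro x y z w r h1 h2
    obtain ⟨a, b, c, s, rfl, rfl, rfl⟩ := loc_common₃ x y z
    obtain ⟨g, d, t, rfl, rfl⟩ := loc_common₂ w r
    obtain ⟨v, hv⟩ := mk_mem_locAdd.1 h1
    obtain ⟨w, hw⟩ := mk_mem_locAdd.1 h2
    have h3 := mul_mem_hadd hv (s * w)
    have h4 := mul_mem_hadd hw (t * v)
    have e1 : g * t * s * v * (s * w) = g * s * s * w * (t * v) := by
      simp only [mul_comm, mul_left_comm]
    rw [e1] at h3
    obtain ⟨h, hh, hd⟩ := hadd_assoc h3 h4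
    have eb : ∀ x : A, Localization.mk x s =
        Localization.mk (x * t * s * w * (t * v)) (s * (t * s * w * (t * v))) := fun x => by
      rw [← loc_mk_mul_mul x s (t * s * w * (t * v))]
      push_cast
      simp only [mul_assoc]
    have ed : Localization.mk d t =
        Localization.mk (d * t * s * v * (s * w)) (s * (t * s * w * (t * v))) := by
      rw [← loc_mk_mul_mul d t (t * s * v * (s * w))]
      congr 1
      · push_cast
        simp only [mul_assoc]
      · simp only [mul_comm, mul_left_comm]
    have ec : c * t * t * v * (s * w) = c * t * s * w * (t * v) := by
      simp only [mul_comm, mul_left_comm]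
    rw [ec] at hh
    refine ⟨Localization.mk h (s * (t * s * w * (t * v))), ?_, ?_⟩
    · rw [eb b, eb c, mk_mem_locAdd_same]
      exact ⟨1, mul_mem_hadd hh _⟩
    · rw [eb a, ed, mk_mem_locAdd_same]
      exact ⟨1, mul_mem_hadd hd _⟩
  hadd_comm := locAdd_comm
  mul_mem_hadd := by
    intro x y z h r
    obtain ⟨a, b, c, s, rfl, rfl, rfl⟩ := loc_common₃ x y z
    obtain ⟨v, hv⟩ := mk_mem_locAdd_same.1 h
    induction r using Localization.induction_on with | _ d
    simp only [mk_mul]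
    refine mk_mem_locAdd_same.2 ⟨v, ?_⟩
    simpa only [mul_right_comm _ d.1] using mul_mem_hadd hv d.1

/-- The morphism `S⁻¹ A → T⁻¹ B` induced by a morphism `f : A → B` with `f(S) ⊆ T`. -/
def locMap {B : Type v} [Multiring B] (f : Hom A B) (S : Submonoid A) (T : Submonoid B)
    (hST : ∀ s ∈ S, f s ∈ T) : Hom (Localization S) (Localization T) where
  toFun x := x.liftOn (fun a s => Localization.mk (f a) ⟨f s, hST s s.2⟩) (by
    intro a c b d h
    obtain ⟨u, hu⟩ := loc_mk_eq_mk.1 (mk_eq_mk_iff.2 h)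
    refine loc_mk_eq_mk.2 ⟨⟨f u, hST u u.2⟩, ?_⟩
    simpa only [map_mul] using congrArg f hu)
  map_zero' := by
    rw [← mk_zero 1, liftOn_mk, map_zero, mk_zero]
  map_one' := by
    rw [← mk_one, liftOn_mk, ← mk_one, loc_mk_eq_mk]
    exact ⟨1, by simp⟩
  map_mul' x y := by
    induction x using Localization.induction_on with | _ x
    induction y using Localization.induction_on with | _ y
    simp only [mk_mul, liftOn_mk, map_mul, Submonoid.coe_mul, MulMemClass.mk_mul_mk]
  map_neg' x := by
    induction x using Localization.induction_on with | _ x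
    simp only [loc_neg_mk, liftOn_mk, f.map_neg]
  map_hadd' := by
    rintro _ _ _ ⟨a, b, c, s, t, u, rfl, rfl, rfl, v, h⟩
    refine mk_mem_locAdd.2 ⟨⟨f v, hST v v.2⟩, ?_⟩
    simpa only [map_mul] using f.map_hadd h

theorem locMap_mk {B : Type v} [Multiring B] (f : Hom A B) (S : Submonoid A) (T : Submonoid B)
    (hST : ∀ s ∈ S, f s ∈ T) (a : A) (s : S) :
    locMap f S T hST (Localization.mk a s) = Localization.mk (f a) ⟨f s, hST s s.2⟩ := rfl

end Loc

section ResidueField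

/-- The multiplicative set of nonzero elements of a (nonzero) multidomain. -/
def nonzeroSubmonoid (D : Type u) [Multiring D] [NoZeroDivisors D] [Nontrivial D] :
    Submonoid D where
  carrier := {x | x ≠ 0}
  one_mem' := one_ne_zero
  mul_mem' := mul_ne_zero

/-- The hyperfield of fractions `ff(D)` of a multidomain. -/
abbrev FractionField (D : Type u) [Multiring D] [NoZeroDivisors D] [Nontrivial D] : Type u :=
  Localization (nonzeroSubmonoid D)

variable {A : Type u} [Multiring A] {B : Type v} [Multiring B]

instance (p : MSpec A) : Nontrivial (IdealQuotient p.toMIdeal) :=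
  ⟨1, 0, fun h => p.one_notMem (IdealQuotient.mk_eq_zero.1 h)⟩

instance (p : MSpec A) : NoZeroDivisors (IdealQuotient p.toMIdeal) where
  eq_zero_or_eq_zero_of_mul_eq_zero := by
    intro a b h
    obtain ⟨a, rfl⟩ := IdealQuotient.mk_surjective a
    obtain ⟨b, rfl⟩ := IdealQuotient.mk_surjective b
    rw [← IdealQuotient.mk_mul, IdealQuotient.mk_eq_zero] at h
    rw [IdealQuotient.mk_eq_zero, IdealQuotient.mk_eq_zero]
    exact p.mem_or_mem' h

/-- The residue hyperfield `K_A(p) = ff(A / p)`. -/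
abbrev ResidueField (p : MSpec A) : Type u := FractionField (IdealQuotient p.toMIdeal)

theorem mk_mem_nonzero {p : MSpec A} {y : A} :
    (IdealQuotient.mk y : IdealQuotient p.toMIdeal) ∈ nonzeroSubmonoid _ ↔ y ∉ p :=
  not_congr IdealQuotient.mk_eq_zero

/-- The fraction `x / y` in `K_A(p)`, for `y ∉ p`. -/
def frac (p : MSpec A) (x y : A) (hy : y ∉ p) : ResidueField p :=
  Localization.mk (IdealQuotient.mk x) ⟨IdealQuotient.mk y, mk_mem_nonzero.2 hy⟩

/-- The morphism `K_A(f⁻¹(p)) → K_B(p)` induced by a morphism `f : A → B`. -/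
def residueMap (f : Hom A B) (p : MSpec B) :
    Hom (ResidueField (MSpec.comap f p)) (ResidueField p) :=
  locMap (IdealQuotient.map f (MSpec.comap f p).toMIdeal p.toMIdeal fun _ h => h) _ _ (by
    intro s hs
    obtain ⟨s, rfl⟩ := IdealQuotient.mk_surjective s
    exact mk_mem_nonzero.2 ((mk_mem_nonzero (p := MSpec.comap f p)).1 hs))

theorem residueMap_frac (f : Hom A B) (p : MSpec B) (x y : A) (hy : y ∉ MSpec.comap f p) :
    residueMap f p (frac _ x y hy) = frac p (f x) (f y) hy := rfl

theorem exists_frac {p : MSpec A} (k : ResidueField p) :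
    ∃ (x y : A) (hy : y ∉ p), k = frac p x y hy := by
  induction k using Localization.induction_on with | _ k
  obtain ⟨x, ⟨y, hy⟩⟩ := k
  obtain ⟨x, rfl⟩ := IdealQuotient.mk_surjective x
  obtain ⟨y, rfl⟩ := IdealQuotient.mk_surjective y
  exact ⟨x, y, mk_mem_nonzero.1 hy, rfl⟩

theorem frac_mul (p : MSpec A) (x y x' y' : A) (hy : y ∉ p) (hy' : y' ∉ p) :
    frac p x y hy * frac p x' y' hy' = frac p (x * x') (y * y') (p.mul_notMem hy hy') :=
  Localization.mk_mul _ _ _ _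

theorem neg_frac (p : MSpec A) (x y : A) (hy : y ∉ p) :
    -frac p x y hy = frac p (-x) y hy := rfl

theorem frac_zero (p : MSpec A) : frac p 0 1 p.one_notMem = 0 := Localization.mk_zero _

theorem frac_one (p : MSpec A) : frac p 1 1 p.one_notMem = 1 := Localization.mk_one

theorem frac_mem_hadd {p : MSpec A} {x₁ y₁ x₂ y₂ x₃ y₃ : A} (h₁ : y₁ ∉ p) (h₂ : y₂ ∉ p)
    (h₃ : y₃ ∉ p) :
    frac p x₁ y₁ h₁ ∈ hadd (frac p x₂ y₂ h₂) (frac p x₃ y₃ h₃) ↔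
      ∃ s ∉ p, ∃ t ∈ p, ∃ a ∈ hadd (x₂ * y₁ * y₃ * s) (x₃ * y₁ * y₂ * s),
        x₁ * y₂ * y₃ * s ∈ hadd a t := by
  refine mk_mem_locAdd.trans ⟨?_, ?_⟩
  · rintro ⟨⟨s, hs⟩, h⟩
    obtain ⟨s, rfl⟩ := IdealQuotient.mk_surjective s
    simp only [← IdealQuotient.mk_mul] at h
    obtain ⟨a, ha, h⟩ := IdealQuotient.mk_mem_qadd.1 h
    obtain ⟨t, ht, h'⟩ := IdealQuotient.exists_of_mk_eq ha.symm
    exact ⟨s, mk_mem_nonzero.1 hs, t, ht, a, h, h'⟩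
  · rintro ⟨s, hs, t, ht, a, h, h'⟩
    refine ⟨⟨IdealQuotient.mk s, mk_mem_nonzero.2 hs⟩, ?_⟩
    simp only [← IdealQuotient.mk_mul]
    exact IdealQuotient.mk_mem_qadd.2 ⟨a, (IdealQuotient.mk_eq_of_mem ht h').symm, h⟩

theorem frac_mul_one (p : MSpec A) (a b : A) :
    frac p (a * b) 1 p.one_notMem = frac p a 1 p.one_notMem * frac p b 1 p.one_notMem := by
  rw [frac_mul]
  simp only [mul_one]

theorem frac_mem_hadd_one (p : MSpec A) {a b c : A} (h : a ∈ hadd b c) :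
    frac p a 1 p.one_notMem ∈ hadd (frac p b 1 p.one_notMem) (frac p c 1 p.one_notMem) := by
  refine (frac_mem_hadd _ _ _).2 ⟨1, p.one_notMem, 0, p.zero_mem', a, ?_, ?_⟩
  · simpa only [mul_one] using h
  · simpa only [mul_one] using mem_hadd_zero.2 rfl

end ResidueField

section SpecTopology

variable {A : Type u} [Multiring A]

/-- `D(a) = {p ∈ spec(A) : a ∉ p}`. -/
def MSpec.basicOpen (a : A) : Set (MSpec A) := {p | a ∉ p}

/-- The spectral topology of `spec(A)`, with the sets `D(a)` as a basis. -/
instance : TopologicalSpace (MSpec A) :=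
  TopologicalSpace.generateFrom (Set.range MSpec.basicOpen)

namespace MSpec

theorem isTopologicalBasis_basicOpen :
    TopologicalSpace.IsTopologicalBasis (Set.range (basicOpen (A := A))) where
  exists_subset_inter := by
    rintro _ ⟨a, rfl⟩ _ ⟨b, rfl⟩ p ⟨ha, hb⟩
    exact ⟨basicOpen (a * b), ⟨a * b, rfl⟩, p.mul_notMem ha hb, fun q hq =>
      ⟨fun h => hq (by rw [mul_comm]; exact q.mul_mem' b h), fun h => hq (q.mul_mem' a h)⟩⟩
  sUnion_eq := Set.eq_univ_of_forall fun p => ⟨_, ⟨1, rfl⟩, p.one_notMem⟩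
  eq_generateFrom := rfl

/-- The characteristic function of a prime ideal, as a point of `2 ^ A`. -/
noncomputable def char (p : MSpec A) (a : A) : Bool := by
  classical exact decide (a ∈ p)

theorem char_eq {p : MSpec A} {a : A} : char p a = true ↔ a ∈ p := by
  simp [char]

theorem isClosed_range_char : IsClosed (Set.range (char (A := A))) := by
  have key : Set.range (char (A := A)) = {g : A → Bool | g 0 = true} ∩ {g | g 1 = false} ∩
      (⋂ (x : A) (y : A) (z : A) (_ : z ∈ hadd x y),
        {g | g x = false ∨ g y = false ∨ g z = true}) ∩
      (⋂ (x : A) (y : A), {g | g y = false ∨ g (x * y) = true}) ∩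
      (⋂ (x : A) (y : A), {g | g (x * y) = false ∨ g x = true ∨ g y = true}) := by
    ext g
    simp only [Set.mem_inter_iff, Set.mem_iInter, Set.mem_ofPred_eq, Set.mem_range]
    constructor
    · rintro ⟨p, rfl⟩
      simp only [← Bool.not_eq_true, char_eq]
      refine ⟨⟨⟨⟨p.zero_mem', p.one_notMem⟩, ?_⟩, ?_⟩, ?_⟩
      · intro x y z hz
        by_contra! h
        exact h.2.2 (p.hadd_mem' h.1 h.2.1 hz)
      · intro x y
        by_contra! h
        exact h.2 (p.mul_mem' x h.1)
      · intro x y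
        by_contra! h
        exact (p.mem_or_mem' h.1).elim h.2.1 h.2.2
    · rintro ⟨⟨⟨⟨h0, h1⟩, h2⟩, h3⟩, h4⟩
      refine ⟨{ carrier := {a | g a = true}
                zero_mem' := h0
                hadd_mem' := ?_
                mul_mem' := ?_
                one_notMem' := by simp [h1]
                mem_or_mem' := ?_ }, ?_⟩
      · intro x y z hx hy hz
        rcases h2 x y z hz with h | h | h <;> simp_all
      · intro a x hx
        rcases h3 a x with h | h <;> simp_all
      · intro a b h
        rcases h4 a b with h' | h' | h' <;> simp_all
      · funext a
        rw [Bool.eq_iff_iff, char_eq]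
        exact Iff.rfl
  have hc : ∀ (a : A) (b : Bool), IsClosed {g : A → Bool | g a = b} := fun a b =>
    isClosed_eq (continuous_apply a) continuous_const
  rw [key]
  refine ((((hc _ _).inter (hc _ _)).inter ?_).inter ?_).inter ?_
  · exact isClosed_iInter fun x => isClosed_iInter fun y => isClosed_iInter fun z =>
      isClosed_iInter fun _ => (hc _ _).union ((hc _ _).union (hc _ _))
  · exact isClosed_iInter fun x => isClosed_iInter fun y => (hc _ _).union (hc _ _)
  · exact isClosed_iInter fun x => isClosed_iInter fun y =>
      (hc _ _).union ((hc _ _).union (hc _ _))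

theorem char_injective : Function.Injective (char (A := A)) := fun p q h =>
  SetLike.ext fun a => by rw [← char_eq, ← char_eq, h]

/-- The topology on `spec(A)` induced from `2 ^ A`. -/
noncomputable abbrev charTopology (A : Type u) [Multiring A] : TopologicalSpace (MSpec A) :=
  TopologicalSpace.induced char inferInstance

theorem compactSpace_char : @CompactSpace _ (charTopology A) := by
  let _ := charTopology A
  have h : Topology.IsClosedEmbedding (char (A := A)) :=
    { eq_induced := rfl, injective := char_injective, isClosed_range := isClosed_range_char }
  exact h.compactSpace

theorem isClopen_char_basicOpen (a : A) : @IsClopen _ (charTopology A) (basicOpen a) := by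
  let _ := charTopology A
  have h : basicOpen a = char ⁻¹' {g : A → Bool | g a = false} := by
    ext p
    simp only [basicOpen, Set.mem_preimage, Set.mem_ofPred_eq, ← Bool.not_eq_true, char_eq]
  rw [h]
  exact (IsClopen.preimage (isClopen_discrete {false}) (continuous_apply a)).preimage
    continuous_induced_dom

theorem char_le : charTopology A ≤ (inferInstance : TopologicalSpace (MSpec A)) := by
  refine le_generateFrom ?_
  rintro _ ⟨a, rfl⟩
  exact (isClopen_char_basicOpen a).2

theorem isCompact_basicOpen (a : A) : IsCompact (basicOpen a) := by
  have h : @IsCompact _ (charTopology A) (basicOpen a) :=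
    @IsClosed.isCompact _ (charTopology A) _ compactSpace_char (isClopen_char_basicOpen a).1
  have := @IsCompact.image _ _ (charTopology A) _ _ id h (continuous_id_of_le char_le)
  simpa using this

theorem char_le_constructible : charTopology A ≤ constructibleTopology (MSpec A) := by
  have key : ∀ s : Set (MSpec A), IsOpen s → IsCompact s → @IsClopen _ (charTopology A) s := by
    intro s ho hc
    obtain ⟨t, ht, rfl⟩ := eq_finite_iUnion_of_isTopologicalBasis_of_isCompact_open _
      isTopologicalBasis_basicOpen s hc ho
    exact @Set.Finite.isClopen_biUnion _ (charTopology A) _ _ _ ht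
      fun a _ => isClopen_char_basicOpen a
  refine le_generateFrom ?_
  rintro s (⟨ho, hc⟩ | ⟨ho, hc⟩)
  · exact (key s ho hc).2
  · have := @IsClopen.compl _ (charTopology A) _ (key sᶜ ho.isOpen_compl hc)
    rw [compl_compl] at this
    exact this.2

theorem isCompact_univ_constructible :
    @IsCompact _ (constructibleTopology (MSpec A)) Set.univ := by
  have := @IsCompact.image _ _ (charTopology A) (constructibleTopology (MSpec A)) _ id
    (@isCompact_univ _ (charTopology A) compactSpace_char)
    (continuous_id_of_le char_le_constructible)
  simpa using this

theorem isClopen_basicOpen (a : A) :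
    @IsClopen _ (constructibleTopology (MSpec A)) (basicOpen a) := by
  have ho : IsOpen (basicOpen a) := isTopologicalBasis_basicOpen.isOpen ⟨a, rfl⟩
  refine ⟨?_, (isCompact_basicOpen a).isOpen_constructibleTopology_of_isOpen ho⟩
  refine @IsClosed.mk _ (constructibleTopology (MSpec A)) _ ?_
  refine IsCompact.isOpen_constructibleTopology_of_isClosed ?_ ho.isClosed_compl
  rw [compl_compl]
  exact isCompact_basicOpen a

end MSpec

end SpecTopology

section Hull

variable {A : Type u} [Multiring A]

/-- `U` is a clopen subset of `spec(A)` with its constructible topology. -/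
def IsConstClopen (U : Set (MSpec A)) : Prop := @IsClopen _ (constructibleTopology (MSpec A)) U

/-- Constructible sections: locally, on sets that are clopen for the constructible topology,
`f(q) = x / y` for some `x, y ∈ A`. -/
def IsConstructibleSection (f : ∀ p : MSpec A, ResidueField p) : Prop :=
  ∀ p : MSpec A, ∃ U : Set (MSpec A), IsConstClopen U ∧ p ∈ U ∧
    ∃ x y : A, ∀ q ∈ U, ∃ hy : y ∉ q, f q = frac q x y hy

theorem IsConstClopen.inter {U V : Set (MSpec A)} (hU : IsConstClopen U) (hV : IsConstClopen V) :
    IsConstClopen (U ∩ V) :=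
  @IsClopen.inter _ (constructibleTopology (MSpec A)) _ _ hU hV

theorem IsConstClopen.union {U V : Set (MSpec A)} (hU : IsConstClopen U) (hV : IsConstClopen V) :
    IsConstClopen (U ∪ V) :=
  @IsClopen.union _ (constructibleTopology (MSpec A)) _ _ hU hV

theorem IsConstClopen.compl {U : Set (MSpec A)} (hU : IsConstClopen U) : IsConstClopen Uᶜ :=
  @IsClopen.compl _ (constructibleTopology (MSpec A)) _ hU

theorem isConstClopen_univ : IsConstClopen (Set.univ : Set (MSpec A)) :=
  @isClopen_univ _ (constructibleTopology (MSpec A))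

theorem isConstClopen_empty : IsConstClopen (∅ : Set (MSpec A)) :=
  @isClopen_empty _ (constructibleTopology (MSpec A))

namespace IsConstructibleSection

theorem const (a : A) : IsConstructibleSection fun p => frac p a 1 p.one_notMem := fun _ =>
  ⟨Set.univ, isConstClopen_univ, trivial, a, 1, fun q _ => ⟨q.one_notMem, rfl⟩⟩

theorem zero : IsConstructibleSection fun p : MSpec A => (0 : ResidueField p) := by
  simpa only [frac_zero] using const (0 : A)

theorem one : IsConstructibleSection fun p : MSpec A => (1 : ResidueField p) := by
  simpa only [frac_one] using const (1 : A)

variable {f g h : ∀ p : MSpec A, ResidueField p}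

theorem mul (hf : IsConstructibleSection f) (hg : IsConstructibleSection g) :
    IsConstructibleSection fun p => f p * g p := by
  intro p
  obtain ⟨U, hU, hpU, x, y, hxy⟩ := hf p
  obtain ⟨V, hV, hpV, z, w, hzw⟩ := hg p
  refine ⟨U ∩ V, hU.inter hV, ⟨hpU, hpV⟩, x * z, y * w, fun q ⟨hqU, hqV⟩ => ?_⟩
  obtain ⟨hy, e1⟩ := hxy q hqU
  obtain ⟨hw, e2⟩ := hzw q hqV
  exact ⟨q.mul_notMem hy hw, by simp only [e1, e2, frac_mul]⟩

theorem neg (hf : IsConstructibleSection f) : IsConstructibleSection fun p => -f p := by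
  intro p
  obtain ⟨U, hU, hpU, x, y, hxy⟩ := hf p
  refine ⟨U, hU, hpU, -x, y, fun q hq => ?_⟩
  obtain ⟨hy, e⟩ := hxy q hq
  exact ⟨hy, by simp only [e, neg_frac]⟩

open Classical in
theorem piecewise {W : Set (MSpec A)} (hW : IsConstClopen W) (hf : ∀ p ∈ W, ∃ U : Set (MSpec A),
      IsConstClopen U ∧ p ∈ U ∧ ∃ x y : A, ∀ q ∈ U, ∃ hy : y ∉ q, f q = frac q x y hy)
    (hg : IsConstructibleSection g) :
    IsConstructibleSection fun p => if p ∈ W then f p else g p := by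
  intro p
  by_cases hp : p ∈ W
  · obtain ⟨U, hU, hpU, x, y, hxy⟩ := hf p hp
    refine ⟨U ∩ W, hU.inter hW, ⟨hpU, hp⟩, x, y, fun q ⟨hqU, hqW⟩ => ?_⟩
    simpa only [if_pos hqW] using hxy q hqU
  · obtain ⟨U, hU, hpU, x, y, hxy⟩ := hg p
    refine ⟨U ∩ Wᶜ, hU.inter hW.compl, ⟨hpU, hp⟩, x, y, fun q ⟨hqU, hqW⟩ => ?_⟩
    simpa only [if_neg hqW] using hxy q hqU

/-- Every element of `K_A(p)` is the value at `p` of a constructible section. -/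
theorem exists_eq (p : MSpec A) (k : ResidueField p) :
    ∃ f : ∀ q : MSpec A, ResidueField q, IsConstructibleSection f ∧ f p = k := by
  classical
  obtain ⟨x, y, hy, rfl⟩ := exists_frac k
  refine ⟨fun q => if q ∈ MSpec.basicOpen y then
    (if h : y ∉ q then frac q x y h else 0) else 0, ?_, ?_⟩
  · refine piecewise (MSpec.isClopen_basicOpen y) (fun q hq => ?_) zero
    exact ⟨_, MSpec.isClopen_basicOpen y, hq, x, y, fun r hr => ⟨hr, dif_pos hr⟩⟩
  · exact (if_pos hy).trans (dif_pos hy)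

/-- If `f(p) ∈ g(p) + h(p)`, then this holds on a neighbourhood of `p`. -/
theorem exists_mem_hadd (hf : IsConstructibleSection f) (hg : IsConstructibleSection g)
    (hh : IsConstructibleSection h) {p : MSpec A} (hp : f p ∈ hadd (g p) (h p)) :
    ∃ U, IsConstClopen U ∧ p ∈ U ∧ ∀ q ∈ U, f q ∈ hadd (g q) (h q) := by
  obtain ⟨U₁, hU₁, hpU₁, x₁, y₁, h₁⟩ := hf p
  obtain ⟨U₂, hU₂, hpU₂, x₂, y₂, h₂⟩ := hg p
  obtain ⟨U₃, hU₃, hpU₃, x₃, y₃, h₃⟩ := hh p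
  obtain ⟨hy₁, e₁⟩ := h₁ p hpU₁
  obtain ⟨hy₂, e₂⟩ := h₂ p hpU₂
  obtain ⟨hy₃, e₃⟩ := h₃ p hpU₃
  rw [e₁, e₂, e₃, frac_mem_hadd] at hp
  obtain ⟨s, hs, t, ht, a, ha, hx⟩ := hp
  refine ⟨U₁ ∩ U₂ ∩ U₃ ∩ (MSpec.basicOpen s ∩ (MSpec.basicOpen t)ᶜ),
    ((hU₁.inter hU₂).inter hU₃).inter ((show IsConstClopen _ from MSpec.isClopen_basicOpen s).inter
      (show IsConstClopen _ from MSpec.isClopen_basicOpen t).compl),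
    ⟨⟨⟨hpU₁, hpU₂⟩, hpU₃⟩, hs, not_not.2 ht⟩, ?_⟩
  rintro q ⟨⟨⟨hq₁, hq₂⟩, hq₃⟩, hqs, hqt⟩
  obtain ⟨hy₁, e₁⟩ := h₁ q hq₁
  obtain ⟨hy₂, e₂⟩ := h₂ q hq₂
  obtain ⟨hy₃, e₃⟩ := h₃ q hq₃
  rw [e₁, e₂, e₃, frac_mem_hadd]
  exact ⟨s, hqs, t, not_not.1 hqt, a, ha, hx⟩

/-- Gluing: a pointwise relation that can be solved locally by constructible sections can be
solved globally, since `spec(A)` is compact in the constructible topology. -/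
theorem glue (R : ∀ q : MSpec A, ResidueField q → Prop)
    (hR : ∀ p, ∃ U, IsConstClopen U ∧ p ∈ U ∧ ∃ f : ∀ q : MSpec A, ResidueField q,
      IsConstructibleSection f ∧ ∀ q ∈ U, R q (f q)) :
    ∃ f : ∀ q : MSpec A, ResidueField q, IsConstructibleSection f ∧ ∀ q, R q (f q) := by
  classical
  have key : ∃ W, IsConstClopen W ∧ Set.univ ⊆ W ∧ ∃ f : ∀ q : MSpec A, ResidueField q,
      IsConstructibleSection f ∧ ∀ q ∈ W, R q (f q) := by
    refine @IsCompact.induction_on _ (constructibleTopology (MSpec A)) _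
      MSpec.isCompact_univ_constructible (fun s => ∃ W, IsConstClopen W ∧ s ⊆ W ∧
        ∃ f : ∀ q : MSpec A, ResidueField q, IsConstructibleSection f ∧ ∀ q ∈ W, R q (f q))
      ?_ ?_ ?_ ?_
    · exact ⟨∅, isConstClopen_empty, subset_rfl, _, zero, fun q hq => hq.elim⟩
    · rintro s t hst ⟨W, hW, ht, h⟩
      exact ⟨W, hW, hst.trans ht, h⟩
    · rintro s t ⟨W₁, hW₁, hs, f₁, hf₁, h₁⟩ ⟨W₂, hW₂, ht, f₂, hf₂, h₂⟩
      refine ⟨W₁ ∪ W₂, hW₁.union hW₂, Set.union_subset_union hs ht, _,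
        piecewise hW₁ (fun p _ => hf₁ p) hf₂, fun q hq => ?_⟩
      by_cases hq₁ : q ∈ W₁
      · simpa only [if_pos hq₁] using h₁ q hq₁
      · simpa only [if_neg hq₁] using h₂ q (hq.resolve_left hq₁)
    · intro p _
      obtain ⟨U, hU, hp, h⟩ := hR p
      have hn : U ∈ @nhds _ (constructibleTopology (MSpec A)) p :=
        @IsOpen.mem_nhds _ (constructibleTopology (MSpec A)) _ _ hU.2 hp
      exact ⟨U, @mem_nhdsWithin_of_mem_nhds _ (constructibleTopology (MSpec A)) _ _ _ hn,
        U, hU, subset_rfl, h⟩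
  obtain ⟨W, _, hW, f, hf, h⟩ := key
  exact ⟨f, hf, fun q => h q (hW trivial)⟩

end IsConstructibleSection

variable (A) in
/-- The von Neumann hull `V(A)`: the set of constructible sections. -/
def Hull : Type u := {f : ∀ p : MSpec A, ResidueField p // IsConstructibleSection f}

namespace Hull

instance : CoeFun (Hull A) fun _ => ∀ p : MSpec A, ResidueField p := ⟨Subtype.val⟩

@[ext]
theorem ext {f g : Hull A} (h : ∀ p, f p = g p) : f = g := Subtype.ext (funext h)

instance : Zero (Hull A) := ⟨⟨_, .zero⟩⟩

instance : One (Hull A) := ⟨⟨_, .one⟩⟩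

instance : Mul (Hull A) := ⟨fun f g => ⟨_, f.2.mul g.2⟩⟩

instance : Neg (Hull A) := ⟨fun f => ⟨_, f.2.neg⟩⟩

theorem zero_apply (p : MSpec A) : (0 : Hull A) p = 0 := rfl

theorem one_apply (p : MSpec A) : (1 : Hull A) p = 1 := rfl

theorem mul_apply (f g : Hull A) (p : MSpec A) : (f * g) p = f p * g p := rfl

theorem neg_apply (f : Hull A) (p : MSpec A) : (-f) p = -f p := rfl

instance : CommMonoidWithZero (Hull A) where
  mul_assoc _ _ _ := ext fun _ => mul_assoc _ _ _
  one_mul _ := ext fun _ => one_mul _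
  mul_one _ := ext fun _ => mul_one _
  mul_comm _ _ := ext fun _ => mul_comm _ _
  zero_mul _ := ext fun _ => zero_mul _
  mul_zero _ := ext fun _ => mul_zero _

/-- The multiring `V(A)`: product and sum are computed pointwise, `f ∈ g + h` meaning
`f(p) ∈ g(p) + h(p)` in `K_A(p)` for every `p ∈ spec(A)`. -/
instance : Multiring (Hull A) where
  hadd g h := {f | ∀ p, f p ∈ hadd (g p) (h p)}
  hadd_nonempty g h := by
    obtain ⟨f, hf, hfR⟩ := IsConstructibleSection.glue (fun q k => k ∈ hadd (g q) (h q)) (by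
      intro p
      obtain ⟨k, hk⟩ := hadd_nonempty (g p) (h p)
      obtain ⟨f, hf, rfl⟩ := IsConstructibleSection.exists_eq p k
      obtain ⟨U, hU, hp, hR⟩ := hf.exists_mem_hadd g.2 h.2 hk
      exact ⟨U, hU, hp, f, hf, hR⟩)
    exact ⟨⟨f, hf⟩, hfR⟩
  mem_hadd_reverse h := ⟨fun p => (mem_hadd_reverse (h p)).1, fun p => (mem_hadd_reverse (h p)).2⟩
  mem_hadd_zero {a b} := by
    refine ⟨fun h => ext fun p => mem_hadd_zero.1 (h p), ?_⟩
    rintro rfl p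
    exact mem_hadd_zero.2 rfl
  hadd_assoc {a b c g x} hx hg := by
    obtain ⟨h, hh, hR⟩ := IsConstructibleSection.glue
      (fun q k => k ∈ hadd (b q) (c q) ∧ x q ∈ hadd (a q) k) (by
        intro p
        obtain ⟨k, hk, hxk⟩ := hadd_assoc (hx p) (hg p)
        obtain ⟨f, hf, rfl⟩ := IsConstructibleSection.exists_eq p k
        obtain ⟨U, hU, hp, hR⟩ := hf.exists_mem_hadd b.2 c.2 hk
        obtain ⟨V, hV, hp', hR'⟩ := x.2.exists_mem_hadd a.2 hf hxk
        exact ⟨U ∩ V, hU.inter hV, ⟨hp, hp'⟩, f, hf, fun q hq => ⟨hR q hq.1, hR' q hq.2⟩⟩)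
    exact ⟨⟨h, hh⟩, fun q => (hR q).1, fun q => (hR q).2⟩
  hadd_comm g h := Set.ext fun f => forall_congr' fun p => by rw [hadd_comm]
  mul_mem_hadd h d := fun p => mul_mem_hadd (h p) (d p)

end Hull

variable (A) in
/-- The canonical morphism `v : A → V(A)`, `v(a)(p) = a / 1`. -/
def toHull : Hom A (Hull A) where
  toFun a := ⟨fun p => frac p a 1 p.one_notMem, .const a⟩
  map_zero' := Hull.ext frac_zero
  map_one' := Hull.ext frac_one
  map_mul' a b := Hull.ext fun p => frac_mul_one p a b
  map_neg' _ := rfl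
  map_hadd' h p := frac_mem_hadd_one p h

end Hull

section RealSpectrum

/-- The hyperfield `3 = {-1, 0, 1}` of signs, with its usual product, `0 + x = x + 0 = {x}`,
`x + x = {x}` and `1 + (-1) = (-1) + 1 = {-1, 0, 1}`. -/
instance : Multiring SignType where
  hadd x y := {z | (x = 0 ∧ z = y) ∨ (y = 0 ∧ z = x) ∨ (x = y ∧ z = x) ∨ (x ≠ 0 ∧ y = -x)}
  hadd_nonempty a b := by
    change ∃ z, _ ∨ _
    revert a b
    decide
  mem_hadd_reverse {a b c} := by
    simp only [Set.mem_ofPred_eq]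
    cases a <;> cases b <;> cases c <;> decide
  mem_hadd_zero {a b} := by
    simp only [Set.mem_ofPred_eq]
    cases a <;> cases b <;> decide
  hadd_assoc {a b c g x} := by
    simp only [Set.mem_ofPred_eq]
    cases a <;> cases b <;> cases c <;> cases g <;> cases x <;> decide
  hadd_comm a b := by
    ext z
    simp only [Set.mem_ofPred_eq]
    cases a <;> cases b <;> cases z <;> decide
  mul_mem_hadd {a b c} := by
    simp only [Set.mem_ofPred_eq]
    cases a <;> cases b <;> cases c <;> decide

/-- The real spectrum: morphisms from `A` to the hyperfield `3` of signs. -/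
def MSper (A : Type u) [Multiring A] : Type u := Hom A SignType

variable {A : Type u} [Multiring A] {B : Type v} [Multiring B]

instance : FunLike (MSper A) A SignType := inferInstanceAs (FunLike (Hom A SignType) A SignType)

/-- The set `U(a₁, …, aₙ)` of orders `σ` with `σ(aᵢ) = 1` for all `i`. -/
def MSper.basicOpen (s : Finset A) : Set (MSper A) := {σ | ∀ a ∈ s, σ a = 1}

/-- The topology of `sper(A)` generated by the sets `U(a₁, …, aₙ)`. -/
instance : TopologicalSpace (MSper A) :=
  TopologicalSpace.generateFrom (Set.range MSper.basicOpen)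

/-- The map `sper(B) → sper(A)` induced by a morphism `f : A → B`. -/
def MSper.comap (f : Hom A B) (σ : MSper B) : MSper A := Hom.comp σ f

end RealSpectrum

end Multiring

/-! `V(A)` behaves like a von Neumann regular ring of functions on the compact space
`spec(A)_const`. A sum relation between sections that holds at a point holds on a clopen
neighbourhood (`exists_mem_hadd`). Since `k = l` means `k ∈ l + 0`, equalities spread too
(`Hull.exists_eqOn`). Nonzero elements of a residue hyperfield are invertible, so a section that is
nonzero at a point is invertible near it. Zero loci are therefore clopen, and conversely each clopen
set `U` has an idempotent section `e_U` that is 1 on `U` and 0 elsewhere.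

Everything rests on `Hull.mem_prime_iff`: a prime `P` of `V(A)` is the set of sections vanishing at
the point `q = v⁻¹(P)`. By compactness some point has no neighbourhood `U` with `e_U ∈ P`.
Multiplying by such an `e_U` turns local identities into identities in `V(A)`, and `e_U` can be
cancelled modulo `P`.

For (i), contraction is thus a bijection, `D(e_U)` is the preimage of `U`, and `D(f)` maps onto the
clopen set where `f` is nonzero. For (iii), a sum relation between fractions of `V(A)` at `P`
amounts to the same relation between values in `K_A(q)`. For (ii), an order of `V(A)` depends only
on values at the point below its support, and every order of `A` extends to the residue hyperfield
of its support. This gives a bijection, which is continuous from a compact space to a Hausdorff one.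
-/

namespace Multiring

/-! ### Residue hyperfields, sections, and the prime ideals of `V(A)`. -/

section HullSections

variable {A : Type u} [Multiring A]

/-- Equality is the membership `k ∈ l + 0`, so the criterion `frac_mem_hadd` for sums of fractions
also decides when a fraction vanishes. -/
theorem frac_eq_zero {p : MSpec A} {x y : A} (hy : y ∉ p) : frac p x y hy = 0 ↔ x ∈ p := by
  rw [← mem_hadd_zero, ← frac_zero, frac_mem_hadd]
  constructor
  · rintro ⟨s, hs, t, ht, a, ha, h⟩
    simp only [zero_mul, mul_one] at ha h
    have ha' := mem_hadd_zero.1 ha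
    rw [ha'] at h
    have := p.hadd_mem' p.zero_mem' ht h
    exact (p.mem_or_mem' this).resolve_right hs
  · intro h
    refine ⟨1, p.one_notMem, x, h, 0, ?_, ?_⟩
    · simp only [zero_mul, mul_one]
      exact mem_hadd_zero.2 rfl
    · simp only [mul_one]
      exact hadd_swap (mem_hadd_zero.2 rfl)

theorem frac_congr (p : MSpec A) {x x' y y' : A} (hx : x = x') (h : y = y') (hy : y ∉ p)
    (hy' : y' ∉ p) : frac p x y hy = frac p x' y' hy' := by
  subst hx h
  rfl

theorem frac_mul_mul (p : MSpec A) {x y c : A} (hy : y ∉ p) (hc : c ∉ p) :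
    frac p (x * c) (y * c) (p.mul_notMem hy hc) = frac p x y hy :=
  loc_mk_mul_mul (IdealQuotient.mk x) ⟨IdealQuotient.mk y, mk_mem_nonzero.2 hy⟩
    ⟨IdealQuotient.mk c, mk_mem_nonzero.2 hc⟩

theorem frac_self (p : MSpec A) {y : A} (hy : y ∉ p) : frac p y y hy = 1 := by
  rw [← frac_one, ← frac_mul_mul p p.one_notMem hy]
  simp only [one_mul]

theorem ResidueField.exists_mul_eq_one {p : MSpec A} {k : ResidueField p} (hk : k ≠ 0) :
    ∃ l, k * l = 1 := by
  obtain ⟨x, y, hy, rfl⟩ := exists_frac k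
  have hx : x ∉ p := fun h => hk ((frac_eq_zero hy).2 h)
  refine ⟨frac p y x hx, ?_⟩
  rw [frac_mul]
  simp only [mul_comm y x]
  exact frac_self p (p.mul_notMem hx hy)

theorem ResidueField.one_ne_zero (p : MSpec A) : (1 : ResidueField p) ≠ 0 := by
  rw [← frac_one, Ne, frac_eq_zero]
  exact p.one_notMem

namespace Hull

theorem toHull_apply (a : A) (p : MSpec A) : toHull A a p = frac p a 1 p.one_notMem := rfl

theorem toHull_apply_eq_zero {a : A} {p : MSpec A} : toHull A a p = 0 ↔ a ∈ p :=
  frac_eq_zero p.one_notMem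

theorem exists_apply_eq (p : MSpec A) (k : ResidueField p) : ∃ f : Hull A, f p = k :=
  let ⟨f, hf, h⟩ := IsConstructibleSection.exists_eq p k
  ⟨⟨f, hf⟩, h⟩

/-- Sections that agree at a point agree on a neighbourhood of it. -/
theorem exists_eqOn {f g : Hull A} {p : MSpec A} (h : f p = g p) :
    ∃ U, IsConstClopen U ∧ p ∈ U ∧ ∀ q ∈ U, f q = g q := by
  -- The equality is read as `f(p) ∈ g(p) + 0`, which spreads to a neighbourhood.
  obtain ⟨U, hU, hp, H⟩ := f.2.exists_mem_hadd g.2 .zero (mem_hadd_zero.2 h)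
  exact ⟨U, hU, hp, fun q hq => mem_hadd_zero.1 (H q hq)⟩

/-- The inverse of `f(p)` in the hyperfield `K_A(p)` is the value of some section `g`; the sections
`f * g` and `1` agree at `p`, hence near `p`. -/
theorem exists_mul_eqOn_one {f : Hull A} {p : MSpec A} (h : f p ≠ 0) :
    ∃ g : Hull A, ∃ U, IsConstClopen U ∧ p ∈ U ∧ ∀ q ∈ U, (f * g) q = 1 := by
  obtain ⟨l, hl⟩ := ResidueField.exists_mul_eq_one h
  obtain ⟨g, rfl⟩ := exists_apply_eq p l
  exact ⟨g, exists_eqOn (f := f * g) (g := 1) hl⟩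

/-- Near a zero `f` agrees with the zero section; near a nonzero `f` has an inverse, so it cannot
vanish there. -/
theorem isConstClopen_zeroLocus (f : Hull A) : IsConstClopen {q | f q = 0} := by
  let _ := constructibleTopology (MSpec A)
  refine ⟨⟨isOpen_iff_forall_mem_open.2 fun p hp => ?_⟩,
    isOpen_iff_forall_mem_open.2 fun p hp => ?_⟩
  · obtain ⟨g, U, hU, hpU, h⟩ := exists_mul_eqOn_one hp
    refine ⟨U, fun q hq hf => ?_, hU.2, hpU⟩
    have := h q hq
    rw [mul_apply, show f q = 0 from hf, zero_mul] at this
    exact ResidueField.one_ne_zero q this.symm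
  · obtain ⟨U, hU, hpU, h⟩ := exists_eqOn (f := f) (g := 0) hp
    exact ⟨U, h, hU.2, hpU⟩

open Classical in
/-- The idempotent of `V(A)` with support a clopen set `U`. -/
noncomputable def indicator {U : Set (MSpec A)} (hU : IsConstClopen U) : Hull A :=
  ⟨fun q => if q ∈ U then 1 else 0,
    IsConstructibleSection.piecewise hU (fun p _ => IsConstructibleSection.one p) .zero⟩

theorem indicator_of_mem {U : Set (MSpec A)} (hU : IsConstClopen U) {q : MSpec A} (hq : q ∈ U) :
    indicator hU q = 1 := if_pos hq

theorem indicator_of_notMem {U : Set (MSpec A)} (hU : IsConstClopen U) {q : MSpec A}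
    (hq : q ∉ U) : indicator hU q = 0 := if_neg hq

theorem indicator_eq_zero {U : Set (MSpec A)} (hU : IsConstClopen U) {q : MSpec A} :
    indicator hU q = 0 ↔ q ∉ U :=
  ⟨fun h hq => ResidueField.one_ne_zero q ((indicator_of_mem hU hq).symm.trans h),
    indicator_of_notMem hU⟩

/-- Turns a local identity of sections into an identity in `V(A)`, to which primes and orders can be
applied. -/
theorem mul_indicator_congr {U : Set (MSpec A)} (hU : IsConstClopen U) {f g : Hull A}
    (h : ∀ q ∈ U, f q = g q) : f * indicator hU = g * indicator hU := by
  ext q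
  by_cases hq : q ∈ U
  · rw [mul_apply, mul_apply, h q hq]
  · rw [mul_apply, mul_apply, indicator_of_notMem hU hq, mul_zero, mul_zero]

/-- Otherwise every point has a clopen neighbourhood whose idempotent lies in `P`. Clopen sets with
this property are stable under finite unions, so compactness would put the idempotent of the whole
space, which is 1, into `P`. -/
theorem exists_indicator_notMem (P : MSpec (Hull A)) :
    ∃ r : MSpec A, ∀ (U : Set (MSpec A)) (hU : IsConstClopen U), r ∈ U → indicator hU ∉ P := by
  by_contra! H
  have key : ∃ W, ∃ hW : IsConstClopen W, Set.univ ⊆ W ∧ indicator hW ∈ P := by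
    refine @IsCompact.induction_on _ (constructibleTopology (MSpec A)) _
      MSpec.isCompact_univ_constructible
      (fun s => ∃ W, ∃ hW : IsConstClopen W, s ⊆ W ∧ indicator hW ∈ P) ?_ ?_ ?_ ?_
    · refine ⟨∅, isConstClopen_empty, subset_rfl, ?_⟩
      rw [show indicator (A := A) isConstClopen_empty = 0 from
        ext fun q => indicator_of_notMem _ (Set.notMem_empty q)]
      exact P.zero_mem'
    · rintro s t hst ⟨W, hW, ht, h⟩
      exact ⟨W, hW, hst.trans ht, h⟩
    · rintro s t ⟨W₁, hW₁, hs, h₁⟩ ⟨W₂, hW₂, ht, h₂⟩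
      refine ⟨W₁ ∪ W₂, hW₁.union hW₂, Set.union_subset_union hs ht, ?_⟩
      -- The second summand is cut down to the complement of `W₁`. The supports are then disjoint,
      -- so at each point one summand is 0 and the sum is single-valued.
      refine P.hadd_mem' h₁ (P.mul_mem' (indicator hW₁.compl) h₂) fun q => ?_
      by_cases hq₁ : q ∈ W₁
      · rw [mul_apply, indicator_of_notMem hW₁.compl (not_not.2 hq₁), zero_mul, mem_hadd_zero,
          indicator_of_mem _ (Or.inl hq₁), indicator_of_mem _ hq₁]
      · rw [mul_apply, indicator_of_mem hW₁.compl hq₁, one_mul, hadd_comm,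
          indicator_of_notMem hW₁ hq₁, mem_hadd_zero]
        by_cases hq₂ : q ∈ W₂
        · rw [indicator_of_mem _ (Or.inr hq₂), indicator_of_mem _ hq₂]
        · rw [indicator_of_notMem _ (not_or.2 ⟨hq₁, hq₂⟩), indicator_of_notMem _ hq₂]
    · intro r _
      obtain ⟨U, hU, hr, h⟩ := H r
      have hn : U ∈ @nhds _ (constructibleTopology (MSpec A)) r :=
        @IsOpen.mem_nhds _ (constructibleTopology (MSpec A)) _ _ hU.2 hr
      exact ⟨U, @mem_nhdsWithin_of_mem_nhds _ (constructibleTopology (MSpec A)) _ _ _ hn,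
        U, hU, subset_rfl, h⟩
  obtain ⟨W, hW, hWu, h⟩ := key
  rw [show indicator hW = 1 from ext fun q => indicator_of_mem hW (hWu trivial)] at h
  exact P.one_notMem h

/-- A prime ideal `P` of `V(A)` consists of the sections that vanish at `v⁻¹(P)`. -/
theorem mem_prime_iff (P : MSpec (Hull A)) (f : Hull A) :
    f ∈ P ↔ f (MSpec.comap (toHull A) P) = 0 := by
  obtain ⟨r, hr⟩ := exists_indicator_notMem P
  have key : ∀ f : Hull A, f ∈ P ↔ f r = 0 := by
    refine fun f => ⟨fun hf => ?_, fun hf => ?_⟩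
    · by_contra h
      obtain ⟨g, U, hU, hrU, H⟩ := exists_mul_eqOn_one h
      refine hr U hU hrU ?_
      -- Since `f * g = 1` on `U`, the idempotent of `U` is a multiple of `f`.
      have e : indicator hU = g * indicator hU * f := by
        rw [mul_comm, ← mul_assoc, mul_indicator_congr hU (g := 1) H, one_mul]
      rw [e]
      exact P.mul_mem' _ hf
    · obtain ⟨U, hU, hrU, H⟩ := exists_eqOn (f := f) (g := 0) hf
      refine (P.mem_or_mem' (a := f) (b := indicator hU) ?_).resolve_right (hr U hU hrU)
      rw [mul_indicator_congr hU H, zero_mul]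
      exact P.zero_mem'
  -- Testing the description of `P` on the sections `v(a)`, which vanish at `r` exactly when `a ∈
  -- r`, identifies `r`.
  have e : MSpec.comap (toHull A) P = r := SetLike.ext fun a =>
    (key (toHull A a)).trans toHull_apply_eq_zero
  rw [e]
  exact key f

variable (A) in
theorem comap_toHull_injective : Function.Injective (MSpec.comap (toHull A)) := fun P Q h =>
  SetLike.ext fun f => by rw [mem_prime_iff, mem_prime_iff, h]

/-- Evaluation of sections at a point. -/
def eval (q : MSpec A) : Hom (Hull A) (ResidueField q) where
  toFun f := f q
  map_zero' := rfl
  map_one' := rfl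
  map_mul' _ _ := rfl
  map_neg' _ := rfl
  map_hadd' h := h q

/-- The zero ideal of a residue hyperfield. -/
def zeroPrime (q : MSpec A) : MSpec (ResidueField q) where
  carrier := {0}
  zero_mem' := rfl
  hadd_mem' := by
    rintro _ _ z rfl rfl h
    exact mem_hadd_zero.1 h
  mul_mem' := by
    rintro a _ rfl
    exact mul_zero a
  one_notMem' := ResidueField.one_ne_zero q
  mem_or_mem' {a b} h := by
    by_contra! H
    obtain ⟨l, hl⟩ := ResidueField.exists_mul_eq_one H.1
    refine H.2 ?_
    calc b = a * b * l := by rw [mul_right_comm, hl, one_mul]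
      _ = 0 := by rw [show a * b = 0 from h, zero_mul]

variable (A) in
-- The prime above `q` is the kernel of evaluation at `q`.
theorem comap_toHull_surjective : Function.Surjective (MSpec.comap (toHull A)) := fun q =>
  ⟨MSpec.comap (eval q) (zeroPrime q), SetLike.ext fun _ => toHull_apply_eq_zero⟩

end Hull

end HullSections

/-! ### Generalities on the constructible topology. -/

section Topology

/-- The generating family of the constructible topology is stable under complements. -/
theorem isClopen_of_mem_constructibleTopologySubbasis {X : Type u} [TopologicalSpace X]
    {s : Set X} (hs : s ∈ constructibleTopologySubbasis X) :
    @IsClopen _ (constructibleTopology X) s :=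
  ⟨@IsClosed.mk _ (constructibleTopology X) _ (TopologicalSpace.isOpen_generateFrom_of_mem
    (compl_mem_constructibleTopologySubbasis_iff.2 hs)),
    TopologicalSpace.isOpen_generateFrom_of_mem hs⟩

/-- Reduces statements about the type synonym carrying `t` to statements about `Y` itself with the
topology `t`. -/
theorem isHomeomorph_toTopology_comp {X : Type u} {Y : Type v} [TopologicalSpace X]
    (t : TopologicalSpace Y) {f : X → Y} (hf : @IsHomeomorph _ _ _ t f) :
    IsHomeomorph fun x => WithTopology.toTopology t (f x) := by
  refine @IsHomeomorph.comp _ _ _ _ t _ _ _ ⟨WithTopology.continuous_toTopology t, ?_,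
    WithTopology.toTopology_bijective t⟩ hf
  intro s hs
  rw [WithTopology.isOpen_iff, Set.preimage_image_eq _ (WithTopology.toTopology_injective t)]
  exact hs

end Topology

/-! ### The homeomorphism of prime spectra. -/

section HullSpec

variable (A : Type u) [Multiring A]

theorem isHomeomorph_comap_toHull : IsHomeomorph (fun p : MSpec (Hull A) =>
    (WithTopology.toTopology _ (MSpec.comap (toHull A) p) :
      WithConstructibleTopology (MSpec A))) := by
  have hc : @Continuous _ _ _ (constructibleTopology (MSpec A)) (MSpec.comap (toHull A)) := by
    refine @continuous_generateFrom_iff _ _ _ _ _ |>.2 fun s hs => ?_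
    have hs' : IsConstClopen s := isClopen_of_mem_constructibleTopologySubbasis hs
    -- A prime of `V(A)` omits the idempotent of `s` exactly when its contraction lies in `s`.
    have e : MSpec.comap (toHull A) ⁻¹' s = MSpec.basicOpen (Hull.indicator hs') := by
      ext P
      change _ ↔ _ ∉ P
      rw [Hull.mem_prime_iff, Hull.indicator_eq_zero, not_not]
      rfl
    rw [e]
    exact MSpec.isTopologicalBasis_basicOpen.isOpen ⟨_, rfl⟩
  have ho : @IsOpenMap _ _ _ (constructibleTopology (MSpec A)) (MSpec.comap (toHull A)) := by
    refine (@TopologicalSpace.IsTopologicalBasis.isOpenMap_iff _ _ _ (constructibleTopology _) _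
      (MSpec.isTopologicalBasis_basicOpen) _).2 ?_
    rintro _ ⟨f, rfl⟩
    -- The image is the locus where `f` does not vanish, already known to be clopen.
    have e : MSpec.comap (toHull A) '' MSpec.basicOpen f = {q | f q = 0}ᶜ := by
      ext q
      constructor
      · rintro ⟨P, hP, rfl⟩ h
        exact hP ((Hull.mem_prime_iff P f).2 h)
      · intro h
        obtain ⟨P, rfl⟩ := Hull.comap_toHull_surjective A q
        exact ⟨P, fun hP => h ((Hull.mem_prime_iff P f).1 hP), rfl⟩
    rw [e]
    exact (Hull.isConstClopen_zeroLocus f).compl.2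
  exact isHomeomorph_toTopology_comp _ (@IsHomeomorph.mk _ _ _ (constructibleTopology _) _ hc ho
    ⟨Hull.comap_toHull_injective A, Hull.comap_toHull_surjective A⟩)

end HullSpec

/-! ### The isomorphism of residue hyperfields. -/

section ResidueIso

variable {A : Type u} [Multiring A]

theorem ResidueField.mem_hadd_of_mul {q : MSpec A} {k l l' m : ResidueField q} (hm : m ≠ 0)
    (h : k * m ∈ hadd (l * m) (l' * m)) : k ∈ hadd l l' := by
  obtain ⟨n, hn⟩ := ResidueField.exists_mul_eq_one hm
  have := mul_mem_hadd h n
  simpa only [mul_assoc, hn, mul_one] using this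

/-- In the criterion `frac_mem_hadd` at `P`, the error term `t` vanishes at `q` and the multiplier
`s` is nonzero there, so evaluation at `q` removes both. Conversely, a relation at `q` holds on a
clopen neighbourhood, whose idempotent serves as multiplier. -/
theorem Hull.frac_mem_hadd_iff {P : MSpec (Hull A)} {x₁ y₁ x₂ y₂ x₃ y₃ : Hull A} (h₁ : y₁ ∉ P)
    (h₂ : y₂ ∉ P) (h₃ : y₃ ∉ P) {q : MSpec A} (hq : q = MSpec.comap (toHull A) P) :
    frac P x₁ y₁ h₁ ∈ hadd (frac P x₂ y₂ h₂) (frac P x₃ y₃ h₃) ↔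
      (x₁ * y₂ * y₃) q ∈ hadd ((x₂ * y₁ * y₃) q) ((x₃ * y₁ * y₂) q) := by
  subst hq
  rw [frac_mem_hadd]
  constructor
  · rintro ⟨s, hs, t, ht, a, ha, h⟩
    rw [mem_prime_iff] at hs ht
    have h' := h (MSpec.comap (toHull A) P)
    rw [ht, mem_hadd_zero] at h'
    have ha' := ha (MSpec.comap (toHull A) P)
    rw [← h'] at ha'
    exact ResidueField.mem_hadd_of_mul hs ha'
  · intro h
    obtain ⟨U, hU, hqU, H⟩ := (x₁ * y₂ * y₃).2.exists_mem_hadd (x₂ * y₁ * y₃).2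
      (x₃ * y₁ * y₂).2 h
    -- With `s = e_U` the relation off `U` becomes `0 ∈ 0 + 0`, so no error term is needed.
    refine ⟨indicator hU, ?_, 0, P.zero_mem', x₁ * y₂ * y₃ * indicator hU, fun r => ?_,
      mem_hadd_zero.2 rfl⟩
    · rw [mem_prime_iff, indicator_eq_zero, not_not]
      exact hqU
    · by_cases hr : r ∈ U
      · exact mul_mem_hadd (H r hr) _
      · simp only [mul_apply, indicator_of_notMem hU hr, mul_zero]
        exact mem_hadd_zero.2 rfl

/-- A surjective morphism that reflects sums is an isomorphism. -/
theorem Hom.isIso_of_surjective {B : Type v} {C : Type w} [Multiring B] [Multiring C]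
    (f : Hom B C) (hs : Function.Surjective f)
    (hr : ∀ a b c, f a ∈ hadd (f b) (f c) → a ∈ hadd b c) : f.IsIso := by
  -- Reflecting sums includes reflecting `a ∈ b + 0`, that is, equality.
  have hi : Function.Injective f := fun a b h => by
    refine mem_hadd_zero.1 (hr a b 0 ?_)
    rw [map_zero, mem_hadd_zero, h]
  obtain ⟨g, hg⟩ := hs.hasRightInverse
  have hg' : ∀ a, g (f a) = a := fun a => hi (hg _)
  refine ⟨{ toFun := g, map_zero' := ?_, map_one' := ?_, map_mul' := fun a b => hi ?_,
            map_neg' := fun a => hi ?_, map_hadd' := fun {a b c} h => hr _ _ _ ?_ }, hg', hg⟩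
  · rw [← map_zero f, hg']
  · rw [← map_one f, hg']
  · rw [map_mul, hg, hg, hg]
  · rw [f.map_neg, hg, hg]
  · rwa [hg, hg, hg]

theorem isIso_residueMap_toHull (P : MSpec (Hull A)) : (residueMap (toHull A) P).IsIso := by
  refine Hom.isIso_of_surjective _ (fun k => ?_) fun a b c h => ?_
  · obtain ⟨F, G, hG, rfl⟩ := exists_frac k
    obtain ⟨x, y, hy, hF⟩ := exists_frac (F (MSpec.comap (toHull A) P))
    obtain ⟨z, w, hw, hG'⟩ := exists_frac (G (MSpec.comap (toHull A) P))
    have hz : z ∉ MSpec.comap (toHull A) P := by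
      rwa [Hull.mem_prime_iff, hG', frac_eq_zero] at hG
    -- At `q` the sections `F` and `G` take the values `x/y` and `z/w`, whose quotient is `xw/(yz)`.
    refine ⟨frac _ (x * w) (y * z) (MSpec.mul_notMem _ hy hz), ?_⟩
    rw [residueMap_frac]
    refine mem_hadd_zero.1 ?_
    rw [← frac_zero]
    refine (Hull.frac_mem_hadd_iff (y₁ := toHull A (y * z)) (MSpec.mul_notMem _ hy hz) hG _
      rfl).2 ?_
    simp only [Hull.mul_apply, Hull.zero_apply, zero_mul, mul_one, mem_hadd_zero,
      hF, hG', Hull.toHull_apply, frac_mul]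
    -- The cross-multiplied sides have denominators `w` and `y`; both are expanded to the common
    -- denominator `wy`.
    rw [← frac_mul_mul _ (MSpec.mul_notMem _ (MSpec.one_notMem _) hw) hy, ← frac_mul_mul _ hy hw]
    refine frac_congr _ ?_ ?_ _ _ <;> simp only [mul_one, mul_comm, mul_left_comm]
  · obtain ⟨x₁, y₁, h₁, rfl⟩ := exists_frac a
    obtain ⟨x₂, y₂, h₂, rfl⟩ := exists_frac b
    obtain ⟨x₃, y₃, h₃, rfl⟩ := exists_frac c
    -- All entries come from `A`, so the values at `q` have denominator 1, and clearing denominators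
    -- in the goal yields the same condition.
    have h := (Hull.frac_mem_hadd_iff (y₁ := toHull A y₁) (y₂ := toHull A y₂)
      (y₃ := toHull A y₃) h₁ h₂ h₃ rfl).1 h
    simp only [← map_mul, Hull.toHull_apply] at h
    rw [frac_mem_hadd] at h ⊢
    simpa only [mul_one] using h

end ResidueIso
-- Orders: extension to residue hyperfields and bijectivity on real spectra.
section HullSper

theorem SignType.mul_self_eq_one {a : SignType} (ha : a ≠ 0) : a * a = 1 := by
  revert ha
  cases a <;> decide

variable {A : Type u} [Multiring A]

namespace MSper

theorem map_zero (σ : MSper A) : σ 0 = 0 := _root_.map_zero (F := Hom A SignType) σ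

theorem map_one (σ : MSper A) : σ 1 = 1 := _root_.map_one (F := Hom A SignType) σ

theorem map_mul (σ : MSper A) (a b : A) : σ (a * b) = σ a * σ b :=
  _root_.map_mul (F := Hom A SignType) σ a b

theorem map_neg (σ : MSper A) (a : A) : σ (-a) = -σ a := Hom.map_neg σ a

theorem map_hadd (σ : MSper A) {a b c : A} (h : a ∈ hadd b c) : σ a ∈ hadd (σ b) (σ c) :=
  Hom.map_hadd σ h

theorem ext {σ τ : MSper A} (h : ∀ a, σ a = τ a) : σ = τ := Hom.ext h

/-- The support of an order. -/
def supp (σ : MSper A) : MSpec A where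
  carrier := {a | σ a = 0}
  zero_mem' := σ.map_zero
  hadd_mem' {x y z} hx hy hz := by
    have h := σ.map_hadd hz
    rw [show σ x = 0 from hx, show σ y = 0 from hy] at h
    exact mem_hadd_zero.1 h
  mul_mem' a x hx := by
    change σ (a * x) = 0
    rw [σ.map_mul, show σ x = 0 from hx, mul_zero]
  one_notMem' h := by
    have h : σ 1 = 0 := h
    rw [σ.map_one] at h
    exact absurd h (by decide)
  mem_or_mem' {a b} h := by
    have h : σ (a * b) = 0 := h
    rw [σ.map_mul] at h
    exact mul_eq_zero.1 h

/-- A nonzero sign is its own inverse, so `σ(x)σ(y)` plays the role of `σ(x)/σ(y)`. This gives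
additivity of the extended order, and with `x₃ = 0` its independence of the chosen fraction. -/
theorem hadd_of_frac_mem_hadd (σ : MSper A) {x₁ y₁ x₂ y₂ x₃ y₃ : A} (h₁ : y₁ ∉ σ.supp)
    (h₂ : y₂ ∉ σ.supp) (h₃ : y₃ ∉ σ.supp)
    (h : frac σ.supp x₁ y₁ h₁ ∈ hadd (frac σ.supp x₂ y₂ h₂) (frac σ.supp x₃ y₃ h₃)) :
    σ x₁ * σ y₁ ∈ hadd (σ x₂ * σ y₂) (σ x₃ * σ y₃) := by
  obtain ⟨s, hs, t, ht, a, ha, h⟩ := (frac_mem_hadd _ _ _).1 h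
  have h' := σ.map_hadd h
  rw [show σ t = 0 from ht] at h'
  -- This factor makes every extra sign occur squared, hence disappear, leaving `σ(xᵢ)σ(yᵢ)` in each
  -- term.
  have ha' := mul_mem_hadd (σ.map_hadd ha) (σ y₁ * σ y₂ * σ y₃ * σ s)
  rw [← mem_hadd_zero.1 h'] at ha'
  simp only [σ.map_mul] at ha'
  have e₁ := SignType.mul_self_eq_one h₁
  have e₂ := SignType.mul_self_eq_one h₂
  have e₃ := SignType.mul_self_eq_one h₃
  have e₄ := SignType.mul_self_eq_one hs
  have key : ∀ x a b c d : SignType, b * b = 1 → c * c = 1 → d * d = 1 →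
      x * b * c * d * (a * b * c * d) = x * a := fun x a b c d hb hc hd => by
    calc x * b * c * d * (a * b * c * d) = x * a * (b * b) * (c * c) * (d * d) := by
          simp only [mul_comm, mul_left_comm]
      _ = x * a := by rw [hb, hc, hd, mul_one, mul_one, mul_one]
  have k₂ : σ x₂ * σ y₁ * σ y₃ * σ s * (σ y₁ * σ y₂ * σ y₃ * σ s) = σ x₂ * σ y₂ := by
    rw [mul_comm (σ y₁) (σ y₂)]
    exact key _ _ _ _ _ e₁ e₃ e₄
  have k₃ : σ x₃ * σ y₁ * σ y₂ * σ s * (σ y₁ * σ y₂ * σ y₃ * σ s) = σ x₃ * σ y₃ := by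
    rw [mul_comm (σ y₁ * σ y₂), ← mul_assoc (σ y₃)]
    exact key _ _ _ _ _ e₁ e₂ e₄
  rwa [key _ _ _ _ _ e₂ e₃ e₄, k₂, k₃] at ha'

/-- An order extends to the residue hyperfield of its support. -/
theorem exists_residueField_hom (σ : MSper A) : ∃ τ : Hom (ResidueField σ.supp) SignType,
    ∀ x y hy, τ (frac σ.supp x y hy) = σ x * σ y := by
  choose x y hy h using exists_frac (p := σ.supp)
  have key : ∀ x' y' hy', σ (x (frac σ.supp x' y' hy')) * σ (y (frac σ.supp x' y' hy'))
      = σ x' * σ y' := fun x' y' hy' => by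
    -- The equality of the chosen fraction with `x'/y'` is used as a sum with third term `0/1`.
    have := σ.hadd_of_frac_mem_hadd (x₃ := 0) (hy (frac σ.supp x' y' hy')) hy'
      σ.supp.one_notMem (by rw [← h, frac_zero, mem_hadd_zero])
    rwa [σ.map_zero, zero_mul, mem_hadd_zero] at this
  refine ⟨{ toFun := fun k => σ (x k) * σ (y k), map_zero' := ?_, map_one' := ?_,
            map_mul' := fun k l => ?_, map_neg' := fun k => ?_,
            map_hadd' := fun {k l m} hk => ?_ }, key⟩
  · rw [← frac_zero, key, σ.map_zero, zero_mul]
  · rw [← frac_one, key, σ.map_one, one_mul]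
  · conv_lhs => rw [h k, h l, frac_mul, key, σ.map_mul, σ.map_mul]
    exact mul_mul_mul_comm _ _ _ _
  · change σ (x (-k)) * σ (y (-k)) = -(σ (x k) * σ (y k))
    conv_lhs => rw [h k, neg_frac, key, σ.map_neg]
    exact (Multiring.neg_mul _ _).symm
  · refine σ.hadd_of_frac_mem_hadd (hy k) (hy l) (hy m) ?_
    rwa [← h, ← h, ← h]

variable (A) in
-- An extension of `σ` is evaluation at its support followed by the induced order of the residue
-- hyperfield.
theorem comap_toHull_surjective : Function.Surjective (MSper.comap (toHull A)) := fun σ => by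
  obtain ⟨τ, hτ⟩ := σ.exists_residueField_hom
  refine ⟨Hom.comp τ (Hull.eval σ.supp), ext fun a => ?_⟩
  exact (hτ a 1 σ.supp.one_notMem).trans (by rw [σ.map_one, mul_one])

theorem apply_eq_zero_iff (σ : MSper (Hull A)) (f : Hull A) :
    σ f = 0 ↔ f (MSpec.comap (toHull A) σ.supp) = 0 :=
  Hull.mem_prime_iff σ.supp f

/-- The sections agree near the point, so they become equal after multiplication by an idempotent on
which `σ` is nonzero, and that sign cancels. -/
theorem apply_congr (σ : MSper (Hull A)) {f g : Hull A}
    (h : f (MSpec.comap (toHull A) σ.supp) = g (MSpec.comap (toHull A) σ.supp)) : σ f = σ g := by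
  obtain ⟨U, hU, hq, H⟩ := Hull.exists_eqOn h
  have hs : σ (Hull.indicator hU) ≠ 0 := by
    rw [Ne, apply_eq_zero_iff, Hull.indicator_eq_zero, not_not]
    exact hq
  have e := congrArg σ (Hull.mul_indicator_congr hU H)
  rw [σ.map_mul, σ.map_mul] at e
  exact mul_right_cancel₀ hs e

variable (A) in
theorem comap_toHull_injective : Function.Injective (MSper.comap (toHull A)) := fun σ τ h => by
  have h' : ∀ a, σ (toHull A a) = τ (toHull A a) := fun a => DFunLike.congr_fun h a
  have hs : MSpec.comap (toHull A) σ.supp = MSpec.comap (toHull A) τ.supp :=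
    SetLike.ext fun a => by
      change σ (toHull A a) = 0 ↔ τ (toHull A a) = 0
      rw [h']
  refine ext fun f => ?_
  obtain ⟨x, y, hy, e⟩ := exists_frac (f (MSpec.comap (toHull A) σ.supp))
  -- With `f(q) = x/y`, the relation `f·v(y) = v(x)` at `q` determines `σ(f)` from the restriction
  -- of `σ` to `A`. Both orders lie over the same `q`, so it applies to each.
  have e' : (f * toHull A y) (MSpec.comap (toHull A) σ.supp) =
      toHull A x (MSpec.comap (toHull A) σ.supp) := by
    rw [Hull.mul_apply, e, Hull.toHull_apply, Hull.toHull_apply, frac_mul,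
      ← frac_mul_mul _ (MSpec.one_notMem _) hy]
    exact frac_congr _ rfl (mul_comm _ _) _ _
  have hσ := σ.apply_congr e'
  rw [hs] at e'
  have hτ := τ.apply_congr e'
  rw [σ.map_mul, h', h'] at hσ
  rw [τ.map_mul, ← hσ] at hτ
  refine (mul_right_cancel₀ ?_ hτ).symm
  rw [← h']
  exact hy

/-! ### The topology of the real spectrum and the homeomorphism of real spectra. -/

theorem isTopologicalBasis_basicOpen :
    TopologicalSpace.IsTopologicalBasis (Set.range (basicOpen (A := A))) where
  exists_subset_inter := by
    classical
    rintro _ ⟨s, rfl⟩ _ ⟨t, rfl⟩ σ ⟨hs, ht⟩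
    refine ⟨basicOpen (s ∪ t), ⟨s ∪ t, rfl⟩, fun a ha => ?_, fun τ hτ =>
      ⟨fun a ha => hτ a (Finset.mem_union_left _ ha),
        fun a ha => hτ a (Finset.mem_union_right _ ha)⟩⟩
    exact (Finset.mem_union.1 ha).elim (hs a) (ht a)
  sUnion_eq := Set.eq_univ_of_forall fun σ =>
    ⟨_, ⟨∅, rfl⟩, fun a ha => absurd ha (Finset.notMem_empty a)⟩
  eq_generateFrom := rfl

/-- An order as a point of `3 ^ A`. -/
def signs (σ : MSper A) (a : A) : SignType := σ a

theorem signs_injective : Function.Injective (signs (A := A)) := fun _ _ h => ext (congrFun h)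

/-- Each axiom of a morphism constrains only finitely many coordinates, so it cuts out a closed
subset of the product of discrete spaces `3 ^ A`. -/
theorem isClosed_range_signs : IsClosed (Set.range (signs (A := A))) := by
  have key : Set.range (signs (A := A)) = {g : A → SignType | g 0 = 0} ∩ {g | g 1 = 1} ∩
      (⋂ (x : A) (y : A), {g | g (x * y) = g x * g y}) ∩ (⋂ x : A, {g | g (-x) = -g x}) ∩
      (⋂ (x : A) (y : A) (z : A) (_ : x ∈ hadd y z),
        {g | (g x, g y, g z) ∈ {t : SignType × SignType × SignType | t.1 ∈ hadd t.2.1 t.2.2}}) := by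
    ext g
    simp only [Set.mem_inter_iff, Set.mem_iInter, Set.mem_ofPred_eq, Set.mem_range]
    constructor
    · rintro ⟨σ, rfl⟩
      exact ⟨⟨⟨⟨σ.map_zero, σ.map_one⟩, σ.map_mul⟩, σ.map_neg⟩, fun _ _ _ h => σ.map_hadd h⟩
    · rintro ⟨⟨⟨⟨h0, h1⟩, hm⟩, hn⟩, ha⟩
      exact ⟨({ toFun := g, map_zero' := h0, map_one' := h1, map_mul' := hm, map_neg' := hn,
                map_hadd' := fun {a b c} h => ha a b c h } : Hom A SignType), rfl⟩
  have hc : ∀ a : A, Continuous fun g : A → SignType => g a := continuous_apply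
  have hd : ∀ t : Set (SignType × SignType × SignType), IsClosed t := fun t => isClosed_discrete t
  rw [key]
  refine ((((isClosed_eq (hc _) continuous_const).inter
    (isClosed_eq (hc _) continuous_const)).inter ?_).inter ?_).inter ?_
  · refine isClosed_iInter fun x => isClosed_iInter fun y => isClosed_eq (hc _) ?_
    exact (continuous_of_discreteTopology (f := fun t : SignType × SignType => t.1 * t.2)).comp
      ((hc x).prodMk (hc y))
  · refine isClosed_iInter fun x => isClosed_eq (hc _) ?_
    exact (continuous_of_discreteTopology (f := fun t : SignType => -t)).comp (hc x)
  · exact isClosed_iInter fun x => isClosed_iInter fun y => isClosed_iInter fun z =>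
      isClosed_iInter fun _ => (hd _).preimage ((hc x).prodMk ((hc y).prodMk (hc z)))

/-- The topology on `sper(A)` induced from `3 ^ A`. -/
abbrev signsTopology (A : Type u) [Multiring A] : TopologicalSpace (MSper A) :=
  TopologicalSpace.induced signs inferInstance

theorem compactSpace_signs : @CompactSpace _ (signsTopology A) := by
  let _ := signsTopology A
  have h : Topology.IsClosedEmbedding (signs (A := A)) :=
    { eq_induced := rfl, injective := signs_injective, isClosed_range := isClosed_range_signs }
  exact h.compactSpace

theorem isClopen_signs_basicOpen (s : Finset A) : @IsClopen _ (signsTopology A) (basicOpen s) := by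
  let _ := signsTopology A
  have h : basicOpen s = ⋂ a ∈ s, signs ⁻¹' {g : A → SignType | g a = 1} := by
    ext σ
    simp only [Set.mem_iInter]
    rfl
  rw [h]
  exact s.finite_toSet.isClopen_biInter fun a _ =>
    (IsClopen.preimage (isClopen_discrete {1}) (continuous_apply a)).preimage
      continuous_induced_dom

theorem signs_le : signsTopology A ≤ (inferInstance : TopologicalSpace (MSper A)) := by
  refine le_generateFrom ?_
  rintro _ ⟨a, rfl⟩
  exact (isClopen_signs_basicOpen a).2

/-- The set is closed in the finer compact topology induced from `3 ^ A`, and compactness survives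
coarsening. -/
theorem isCompact_basicOpen (s : Finset A) : IsCompact (basicOpen s) := by
  have h : @IsCompact _ (signsTopology A) (basicOpen s) :=
    @IsClosed.isCompact _ (signsTopology A) _ compactSpace_signs (isClopen_signs_basicOpen s).1
  have := @IsCompact.image _ _ (signsTopology A) _ _ id h (continuous_id_of_le signs_le)
  simpa using this

instance : CompactSpace (MSper A) where
  isCompact_univ := by
    have h : (Set.univ : Set (MSper A)) = basicOpen ∅ :=
      (Set.eq_univ_of_forall fun σ a ha => absurd ha (Finset.notMem_empty a)).symm
    rw [h]
    exact isCompact_basicOpen ∅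

theorem isClopen_basicOpen (s : Finset A) :
    @IsClopen _ (constructibleTopology (MSper A)) (basicOpen s) :=
  isClopen_of_mem_constructibleTopologySubbasis
    (Or.inl ⟨isTopologicalBasis_basicOpen.isOpen ⟨s, rfl⟩, isCompact_basicOpen s⟩)

theorem mem_basicOpen_singleton {σ : MSper A} {a : A} : σ ∈ basicOpen {a} ↔ σ a = 1 :=
  ⟨fun h => h a (Finset.mem_singleton_self a), fun h _ hb => Finset.mem_singleton.1 hb ▸ h⟩

/-- A sign `s` is determined by whether `s = 1` and whether `-s = 1`, so distinct orders are
separated by some clopen `U(a)`. -/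
theorem t2Space_constructible : @T2Space _ (constructibleTopology (MSper A)) := by
  let _ := constructibleTopology (MSper A)
  refine ⟨fun σ τ h => ?_⟩
  have H : ∃ a, ¬(σ a = 1 ↔ τ a = 1) := by
    by_contra! H
    refine h (ext fun a => ?_)
    have h₁ := H a
    have h₂ := H (-a)
    rw [σ.map_neg, τ.map_neg] at h₂
    generalize σ a = s at h₁ h₂ ⊢
    generalize τ a = t at h₁ h₂ ⊢
    revert h₁ h₂
    cases s <;> cases t <;> decide
  obtain ⟨a, ha⟩ := H
  rw [← mem_basicOpen_singleton, ← mem_basicOpen_singleton] at ha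
  have hc : IsClopen (basicOpen {a}) := isClopen_basicOpen {a}
  by_cases hσ : σ ∈ basicOpen {a}
  · exact ⟨_, _, hc.2, hc.compl.2, hσ, fun hτ => ha (iff_of_true hσ hτ), disjoint_compl_right⟩
  · exact ⟨_, _, hc.compl.2, hc.2, hσ, by_contra fun hτ => ha (iff_of_false hσ hτ),
      disjoint_compl_left⟩

theorem isOpen_apply_eq_one (a : A) : IsOpen {σ : MSper A | σ a = 1} := by
  have h : {σ : MSper A | σ a = 1} = basicOpen {a} :=
    Set.ext fun σ => mem_basicOpen_singleton.symm
  rw [h]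
  exact isTopologicalBasis_basicOpen.isOpen ⟨_, rfl⟩

/-- The complement consists of the orders with `σ(f) = -1` or `σ(f) = 0`. The second condition is
open because over `V(A)` it says that `σ` is 1 on the idempotent of the zero locus of `f`. -/
theorem isClopen_apply_eq_one (f : Hull A) : IsClopen {σ : MSper (Hull A) | σ f = 1} := by
  refine ⟨⟨?_⟩, isOpen_apply_eq_one f⟩
  have h : {σ : MSper (Hull A) | σ f = 1}ᶜ = {σ | σ (-f) = 1} ∪
      {σ | σ (Hull.indicator (Hull.isConstClopen_zeroLocus f)) = 1} := by
    ext σ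
    have h₀ : σ (Hull.indicator (Hull.isConstClopen_zeroLocus f)) = 1 ↔ σ f = 0 := by
      rw [apply_eq_zero_iff]
      constructor
      · intro h
        by_contra hf
        rw [(apply_eq_zero_iff _ _).2 (Hull.indicator_of_notMem _ hf)] at h
        exact absurd h (by decide)
      · intro hf
        rw [← σ.map_one]
        exact σ.apply_congr (Hull.indicator_of_mem _ hf)
    simp only [Set.mem_union, Set.mem_compl_iff, Set.mem_ofPred_eq, h₀, σ.map_neg]
    generalize σ f = s
    cases s <;> decide
  rw [h]
  exact (isOpen_apply_eq_one _).union (isOpen_apply_eq_one _)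

variable (A) in
-- A compact open set is a finite union of sets `U(a₁, …, aₙ)`, whose preimages are finite
-- intersections of clopen sets `{σ | σ(v(a)) = 1}`.
theorem continuous_comap_toHull :
    @Continuous _ _ _ (constructibleTopology (MSper A)) (MSper.comap (toHull A)) := by
  have key : ∀ s : Set (MSper A), IsOpen s → IsCompact s →
      IsClopen (MSper.comap (toHull A) ⁻¹' s) := by
    intro s ho hc
    obtain ⟨t, ht, rfl⟩ := eq_finite_iUnion_of_isTopologicalBasis_of_isCompact_open _
      isTopologicalBasis_basicOpen s hc ho
    rw [Set.preimage_iUnion₂]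
    refine ht.isClopen_biUnion fun s _ => ?_
    have e : MSper.comap (toHull A) ⁻¹' basicOpen s =
        ⋂ a ∈ s, {σ : MSper (Hull A) | σ (toHull A a) = 1} := by
      ext σ
      simp only [Set.mem_iInter]
      rfl
    rw [e]
    exact s.finite_toSet.isClopen_biInter fun a _ => isClopen_apply_eq_one _
  refine @continuous_generateFrom_iff _ _ _ _ _ |>.2 ?_
  rintro s (⟨ho, hc⟩ | ⟨ho, hc⟩)
  · exact (key s ho hc).2
  · have := (key sᶜ ho.isOpen_compl hc).compl
    rw [← Set.preimage_compl, compl_compl] at this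
    exact this.2

variable (A) in
-- A continuous bijection from the compact space `sper(V(A))` to a Hausdorff space.
theorem isHomeomorph_comap_toHull : IsHomeomorph (fun σ : MSper (Hull A) =>
    (WithTopology.toTopology _ (MSper.comap (toHull A) σ) :
      WithConstructibleTopology (MSper A))) :=
  isHomeomorph_toTopology_comp _ ((@isHomeomorph_iff_continuous_bijective _ _ _
    (constructibleTopology (MSper A)) _ _ t2Space_constructible).2
      ⟨continuous_comap_toHull A, comap_toHull_injective A, comap_toHull_surjective A⟩)

end MSper

end HullSper

end Multiring

theorem mainTheorem8 (A : Type u) [Multiring A] :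
    IsHomeomorph (fun p : Multiring.MSpec (Multiring.Hull A) =>
        (WithTopology.toTopology _ (Multiring.MSpec.comap (Multiring.toHull A) p) :
          WithConstructibleTopology (Multiring.MSpec A))) ∧
      IsHomeomorph (fun σ : Multiring.MSper (Multiring.Hull A) =>
        (WithTopology.toTopology _ (Multiring.MSper.comap (Multiring.toHull A) σ) :
          WithConstructibleTopology (Multiring.MSper A))) ∧
      ∀ p : Multiring.MSpec (Multiring.Hull A),
        (Multiring.residueMap (Multiring.toHull A) p).IsIso :=
  ⟨Multiring.isHomeomorph_comap_toHull A, Multiring.MSper.isHomeomorph_comap_toHull A,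
    Multiring.isIso_residueMap_toHull⟩
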